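/- Conventions. For a directed acyclic graph $G$ and a set $S$ of nodes, $G-S$ is the graph obtained from $G$ by deleting the nodes in $S$. The length of a directed path is its number of nodes. $G$ is $(e,d)$-depth-robust if for every set $S$ of at most $e$ nodes, $G-S$ contains a directed path of length at least $d$. For a constant $c>0$, call $(H_n)_{n\ge 1}$ a $c$-depth-robust family of constant indegree if there is a constant $\delta$ such that for every $n\ge 1$, $H_n$ is a directed acyclic graph with $n$ nodes and indegree at most $\delta$ that is $(cn,n^{2/3})$-depth-robust. Construction of $G_n$. Given $H_n$ and an integer $\tau$, take three isomorphic copies $H_n^1,H_n^2,H_n^3$ of $H_n$ with disjoint node sets $V_1,V_2,V_3$. For each $v\in V_3$ sample $x_1^v,\dots,x_\tau^v$ from $V_2$ and for each $u\in V_2$ sample $x_1^u,\dots,x_\tau^u$ from $V_1$, all independently and uniformly at random, and add the directed edges $(x_i^v,v)$ and $(x_i^u,u)$ for all $i\le\tau$. Statement. (1) For some constant $c>0$ there exists a $c$-depth-robust family $(H_n)_{n\ge1}$ of constant indegree. (2) For every $c>0$ there is a constant $\tau_0$, depending only on $c$, such that for every $\tau\ge\tau_0$, every $c$-depth-robust family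 $(H_n)_{n\ge 1}$ of constant indegree and every $n\ge1$, with probability at least $1-2^{-n}$ (in particular with high probability as $n \to\infty$) the random graph $G_n$ has the following property: for every $S\subseteq V(G_n)$ with $|S|\le cn/2$ there exist $A\subseteq V(H_n^1)$ and $B\subseteq V(H_n^3)$ with $|A|,|B|\ge 9cn/40$ such that for all $u\in A$ and $v\in B$ the graph $G_n-S$ contains a directed path from $u$ to $v$. -/

import Mathlib

namespace STRobust

/-- A finite list of vertices is a (nonempty, simple) directed path of `G - S`: consecutive vertices
are joined by edges of `G`, no vertex is repeated, and no vertex lies in `S`. -/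
def IsPathAvoiding {V : Type*} (G : Digraph V) (S : Finset V) (l : List V) : Prop :=
  l ≠ [] ∧ l.IsChain G.Adj ∧ l.Nodup ∧ ∀ v ∈ l, v ∉ S

/-- The graph `G - S` contains a directed path from `u` to `v`. -/
def ConnectedAvoiding {V : Type*} (G : Digraph V) (S : Finset V) (u v : V) : Prop :=
  ∃ l : List V, IsPathAvoiding G S l ∧ l.head? = some u ∧ l.getLast? = some v

/-- `G` is a DAG: no vertex lies on a directed cycle. -/
def IsAcyclic {V : Type*} (G : Digraph V) : Prop :=
  ∀ v : V, ¬ Relation.TransGen G.Adj v v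

/-- Every vertex of `G` has at most `δ` incoming edges. -/
def IndegreeAtMost {V : Type*} (G : Digraph V) (δ : ℕ) : Prop :=
  ∀ v : V, {u : V | G.Adj u v}.encard ≤ δ

/-- `(e, d)`-depth-robustness: after deleting any set of at most `e` nodes there remains a directed
path of length `d`, the length of a path being its number of nodes. -/
def DepthRobust {V : Type*} (G : Digraph V) (e d : ℝ) : Prop :=
  ∀ S : Finset V, (S.card : ℝ) ≤ e → ∃ l : List V, IsPathAvoiding G S l ∧ d ≤ (l.length : ℝ)

/-- A family `(H_n)` of DAGs, `H_n` having `n` nodes, indegree at most the constant `δ`, and being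
`(c n, n^{2/3})`-depth-robust. -/
def IsDepthRobustFamily (c : ℝ) (δ : ℕ) (H : (n : ℕ) → Digraph (Fin n)) : Prop :=
  ∀ n : ℕ, 1 ≤ n → IsAcyclic (H n) ∧ IndegreeAtMost (H n) δ ∧
    DepthRobust (H n) (c * n) ((n : ℝ) ^ (2 / 3 : ℝ))

/-- The outcomes of the random choices: `ω 0 u i` is the `i`-th node of the first layer sampled for
the node `u` of the second layer, and `ω 1 v i` is the `i`-th node of the second layer sampled for
the node `v` of the third layer. The samples are independent and uniform exactly when `ω` is
uniformly distributed over this finite set. -/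
abbrev Samples (n τ : ℕ) : Type := Fin 2 → Fin n → Fin τ → Fin n

/-- The graph `G_n` for given samples: three disjoint copies `{0} × V`, `{1} × V`, `{2} × V` of `H`,
together with an edge from each sampled node to the node it was sampled for. -/
def threeLayer {n τ : ℕ} (H : Digraph (Fin n)) (ω : Samples n τ) : Digraph (Fin 3 × Fin n) where
  Adj x y :=
    (x.1 = y.1 ∧ H.Adj x.2 y.2) ∨
    (x.1 = 0 ∧ y.1 = 1 ∧ ∃ i : Fin τ, ω 0 y.2 i = x.2) ∨
    (x.1 = 1 ∧ y.1 = 2 ∧ ∃ i : Fin τ, ω 1 y.2 i = x.2)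

/-- After deleting any set `S` of at most `c n / 2` nodes of the three-layer graph `G`, there are a
set `A` of nodes of the first layer and a set `B` of nodes of the third layer, each of size at least
`9 c n / 40`, such that `G - S` contains a path from every node of `A` to every node of `B`. -/
def RobustlyConnected {n : ℕ} (c : ℝ) (G : Digraph (Fin 3 × Fin n)) : Prop :=
  ∀ S : Finset (Fin 3 × Fin n), (S.card : ℝ) ≤ c * n / 2 →
    ∃ A B : Finset (Fin 3 × Fin n),
      (∀ u ∈ A, u.1 = 0) ∧ (∀ v ∈ B, v.1 = 2) ∧
      9 * c * n / 40 ≤ (A.card : ℝ) ∧ 9 * c * n / 40 ≤ (B.card : ℝ) ∧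
      ∀ u ∈ A, ∀ v ∈ B, ConnectedAvoiding G S u v

end STRobust

namespace STRobust

/-! Three layers. Fix `S`. It uses at most half of the deletion budget `c n`, so removing long paths
greedily yields in each layer `k` disjoint paths of `L = ⌈n^(2/3)⌉` nodes that avoid `S`, with `k L
≥ c n / 2` (`DepthRobust.exists_isPathFamily`). Mark a block of `m = ⌊L/4⌋` nodes at both ends of
every path. Two paths in consecutive layers are linked if a sample joins the last block of one to
the first block of the other. If fewer than `k² / 8` pairs are unlinked at both passages, at least
`3k/4` paths of each outer layer are linked to more than half of the middle paths, so any two of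
them share a middle path. Their nodes outside one end block give `A` and `B`, of size at least
`(3k/4)(3L/4) ≥ 9cn/32` (`exists_connected_sets`). Otherwise the samples miss at least `(k²/8) m²`,
hence `c² n² / 2048`, pairs of nodes, which has probability at most `exp(-τ c² n / 2048)`
(`card_avoiding_le`). The path families depend only on the trace of `S` on each layer, and `k² ≤ n`,
so a union bound over `2^(4n)` events suffices.

Depth-robust graphs. Take `2^t` ordered groups of nodes; each node draws a bounded number of
samples, each at a uniformly random dyadic scale. If `G - S` had only paths with fewer than `d`
nodes, longest paths would give labels below `d` that increase along edges. Replace the labels in a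
group by their median `θ`: no edge may lead from an upper-half node of a group `w` to a lower-half
node of a later group `v` with `θ w ≥ θ v`. As `d` is much smaller than `2^t`, such inversions are
frequent on average over the dyadic scales (`le_sum_inversions`): few labels force the entropy sum
`∑ m log m` of the class sizes to be large, whereas merging two halves of a block with few
inversions barely increases it (`labelEntropy_union_le`). So each choice of halves and medians
forbids many samples, and a union bound over these choices leaves a good graph. -/

/-! ### Union bound for samples that avoid prescribed sets -/

open Classical in
/-- The samples that avoid prescribed sets `T a y` are exponentially rare. -/
theorem card_avoiding_le {A Y X : Type*} [Fintype A] [Fintype Y] [Fintype X] (τ : ℕ)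
    (T : A → Y → Finset X) :
    ({ω : A → Y → Fin τ → X | ∀ a y k, ω a y k ∉ T a y}.ncard : ℝ) ≤
      Nat.card (A → Y → Fin τ → X) *
        Real.exp (-(τ * ((∑ a, ∑ y, ((T a y).card : ℝ)) / Fintype.card X))) := by
  have hset : {ω : A → Y → Fin τ → X | ∀ a y k, ω a y k ∉ T a y} =
      (Fintype.piFinset fun a => Fintype.piFinset fun y => Fintype.piFinset fun _ : Fin τ =>
        (T a y)ᶜ : Finset (A → Y → Fin τ → X)) := by
    ext ω
    simp
  have hpt : ∀ s : Finset X, ((sᶜ.card : ℕ) : ℝ) ≤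
      Fintype.card X * Real.exp (-((s.card : ℝ) / Fintype.card X)) := by
    intro s
    rw [Finset.card_compl, Nat.cast_sub (Finset.card_le_univ s)]
    rcases Nat.eq_zero_or_pos (Fintype.card X) with h | h
    · simp [h]
    · have hX : (0 : ℝ) < Fintype.card X := by exact_mod_cast h
      have := Real.add_one_le_exp (-((s.card : ℝ) / Fintype.card X))
      calc (Fintype.card X : ℝ) - s.card
          = Fintype.card X * (-((s.card : ℝ) / Fintype.card X) + 1) := by field_simp; ring
        _ ≤ _ := by gcongr
  rw [hset, Set.ncard_coe_finset, Nat.card_eq_fintype_card, Fintype.card_piFinset]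
  simp only [Fintype.card_piFinset, Finset.prod_const, Finset.card_univ, Fintype.card_fin,
    Fintype.card_pi]
  push_cast
  calc (∏ a, ∏ y, (((T a y)ᶜ.card : ℕ) : ℝ) ^ τ)
      ≤ ∏ a, ∏ y, ((Fintype.card X : ℝ) *
          Real.exp (-(((T a y).card : ℝ) / Fintype.card X))) ^ τ := by
        refine Finset.prod_le_prod (fun a _ => Finset.prod_nonneg fun y _ => by positivity)
          fun a _ => Finset.prod_le_prod (fun y _ => by positivity) fun y _ => ?_
        exact pow_le_pow_left₀ (by positivity) (hpt _) _
    _ = _ := by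
        simp only [mul_pow, Finset.prod_mul_distrib, ← Real.exp_nat_mul, ← Real.exp_sum,
          Finset.prod_const, Finset.card_univ]
        congr 2
        simp only [mul_neg, Finset.sum_neg_distrib, ← Finset.mul_sum, Finset.sum_div]

/-- Union bound: the samples avoiding one of finitely many families of sets, each of total relative
size at least `σ`. -/
theorem card_exists_avoiding_le {A Y X D : Type*} [Fintype A] [Fintype Y] [Fintype X] (τ : ℕ)
    (Δ : Finset D) (T : D → A → Y → Finset X) (σ : ℝ)
    (hσ : ∀ d ∈ Δ, σ * Fintype.card X ≤ ∑ a, ∑ y, ((T d a y).card : ℝ))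
    (hX : 0 < Fintype.card X) :
    ({ω : A → Y → Fin τ → X | ∃ d ∈ Δ, ∀ a y k, ω a y k ∉ T d a y}.ncard : ℝ) ≤
      Δ.card * (Nat.card (A → Y → Fin τ → X) * Real.exp (-(τ * σ))) := by
  have hset : {ω : A → Y → Fin τ → X | ∃ d ∈ Δ, ∀ a y k, ω a y k ∉ T d a y} =
      ⋃ d ∈ Δ, {ω : A → Y → Fin τ → X | ∀ a y k, ω a y k ∉ T d a y} := by
    ext ω
    simp
  have h1 := Finset.set_ncard_biUnion_le Δ fun d =>
    {ω : A → Y → Fin τ → X | ∀ a y k, ω a y k ∉ T d a y}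
  rw [← hset] at h1
  calc _ ≤ ((∑ d ∈ Δ, {ω : A → Y → Fin τ → X | ∀ a y k, ω a y k ∉ T d a y}.ncard : ℕ) : ℝ) := by
        exact_mod_cast h1
    _ ≤ ∑ d ∈ Δ, (Nat.card (A → Y → Fin τ → X) * Real.exp (-(τ * σ))) := by
        push_cast
        refine Finset.sum_le_sum fun d hd => (card_avoiding_le τ (T d)).trans ?_
        have hX' : (0 : ℝ) < Fintype.card X := by exact_mod_cast hX
        have := (le_div_iff₀ hX').2 (hσ d hd)
        gcongr
    _ = _ := by simp

/-! ### Paths in acyclic graphs and families of disjoint paths -/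

/-- In an acyclic digraph, reachability through undeleted nodes gives a simple path. -/
theorem connectedAvoiding_of_reflTransGen {V : Type*} {G : Digraph V} (hG : IsAcyclic G)
    {S : Finset V} {u v : V} (hu : u ∉ S)
    (h : Relation.ReflTransGen (fun x y => G.Adj x y ∧ y ∉ S) u v) :
    ConnectedAvoiding G S u v := by
  obtain ⟨l, hl, hlast⟩ := List.exists_isChain_cons_of_relationReflTransGen h
  refine ⟨u :: l, ⟨by simp, hl.imp fun _ _ h => h.1, ?_, ?_⟩, by simp, ?_⟩
  · have h1 : (u :: l).IsChain (Relation.TransGen G.Adj) :=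
      hl.imp fun _ _ h => Relation.TransGen.single h.1
    have h2 := List.isChain_iff_pairwise.1 h1
    refine h2.imp ?_
    rintro a b hab rfl
    exact hG a hab
  · have key : ∀ (l : List V) (u : V), u ∉ S →
        (u :: l).IsChain (fun x y => G.Adj x y ∧ y ∉ S) → ∀ x ∈ u :: l, x ∉ S := by
      intro l
      induction l with
      | nil => intro u hu _ x hx; simp at hx; exact hx ▸ hu
      | cons b l ih =>
        intro u hu hc x hx
        rw [List.isChain_cons_cons] at hc
        rcases List.mem_cons.1 hx with rfl | hx
        · exact hu
        · exact ih b hc.1.2 hc.2 x hx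
    exact key l u hu hl
  · rw [List.getLast?_eq_some_getLast (by simp), hlast]

theorem isAcyclic_threeLayer {n τ : ℕ} {H : Digraph (Fin n)} (hH : IsAcyclic H)
    (ω : Samples n τ) : IsAcyclic (threeLayer H ω) := by
  have key : ∀ x y, Relation.TransGen (threeLayer H ω).Adj x y →
      x.1 < y.1 ∨ (x.1 = y.1 ∧ Relation.TransGen H.Adj x.2 y.2) := by
    have step : ∀ x y, (threeLayer H ω).Adj x y → x.1 < y.1 ∨ (x.1 = y.1 ∧ H.Adj x.2 y.2) := by
      rintro x y (h | ⟨h1, h2, -⟩ | ⟨h1, h2, -⟩)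
      · exact Or.inr h
      · left; rw [h1, h2]; decide
      · left; rw [h1, h2]; decide
    intro x y h
    induction h with
    | single h =>
      exact (step _ _ h).imp id fun h => ⟨h.1, .single h.2⟩
    | tail _ h ih =>
      rcases ih with ih | ih <;> rcases step _ _ h with h | h
      · exact Or.inl (ih.trans h)
      · exact Or.inl (h.1 ▸ ih)
      · exact Or.inl (ih.1 ▸ h)
      · exact Or.inr ⟨ih.1.trans h.1, ih.2.tail h.2⟩
  intro v h
  rcases key v v h with h | h
  · exact lt_irrefl _ h
  · exact hH _ h.2

/-- `p i` for `i < k` are disjoint directed paths with `L` nodes each that avoid `S`. -/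
structure IsPathFamily {V : Type*} (G : Digraph V) (S : Finset V) (k L : ℕ) (p : ℕ → ℕ → V) :
    Prop where
  notMem : ∀ i < k, ∀ l < L, p i l ∉ S
  adj : ∀ i < k, ∀ l, l + 1 < L → G.Adj (p i l) (p i (l + 1))
  inj : ∀ i < k, ∀ l < L, ∀ i' < k, ∀ l' < L, p i l = p i' l' → i = i' ∧ l = l'

/-- Greedy extraction: delete `S` together with the paths found so far and apply depth-robustness
again. Since path lengths are integers, `L < d + 1` allows `L = ⌈d⌉`. -/
theorem DepthRobust.exists_isPathFamily {V : Type*} [Nonempty V] {G : Digraph V} {e d : ℝ}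
    (hG : DepthRobust G e d) {L : ℕ} (hL : (L : ℝ) < d + 1) (S : Finset V) (k : ℕ)
    (hk : ∀ j < k, (S.card : ℝ) + j * L ≤ e) : ∃ p, IsPathFamily G S k L p := by
  classical
  induction k with
  | zero => exact ⟨fun _ _ => Classical.arbitrary V, ⟨by simp, by simp, by simp⟩⟩
  | succ k ih =>
    obtain ⟨p, hp⟩ := ih fun j hj => hk j (hj.trans k.lt_succ_self)
    set S' := S ∪ (Finset.range k ×ˢ Finset.range L).image fun x => p x.1 x.2 with hS'
    have hcard : (S'.card : ℝ) ≤ e := by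
      have h1 : S'.card ≤ S.card + k * L := by
        refine (Finset.card_union_le _ _).trans ?_
        gcongr
        exact Finset.card_image_le.trans (by simp)
      have h2 : (S'.card : ℝ) ≤ S.card + k * L := by exact_mod_cast h1
      exact h2.trans (hk k k.lt_succ_self)
    obtain ⟨q, ⟨-, hchain, hnodup, havoid⟩, hlen⟩ := hG S' hcard
    have hlen' : L ≤ q.length := by
      have : (L : ℝ) < (q.length + 1 : ℕ) := by push_cast; linarith
      exact Nat.lt_succ_iff.1 (by exact_mod_cast this)
    -- The default value is never met, since only indices below `L ≤ q.length` are used.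
    let r : ℕ → V := fun l => q.getD l (Classical.arbitrary V)
    have hr : ∀ l (h : l < L), r l = q[l]'(h.trans_le hlen') := fun l h => by
      exact List.getD_eq_getElem _ _ (h.trans_le hlen')
    have hrS : ∀ l < L, r l ∉ S' := fun l h => by
      rw [hr l h]; exact havoid _ (List.getElem_mem _)
    have hrp : ∀ l < L, ∀ i < k, ∀ l' < L, p i l' ≠ r l := fun l h i hi l' hl' he => by
      refine hrS l h ?_
      rw [hS', ← he]
      refine Finset.mem_union_right _ (Finset.mem_image.2 ⟨(i, l'), ?_, rfl⟩)
      simp [hi, hl']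
    refine ⟨fun i => if i = k then r else p i, ⟨?_, ?_, ?_⟩⟩
    · intro i hi l hl
      by_cases h : i = k
      · simp only [h, if_true]
        exact fun hm => hrS l hl (Finset.mem_union_left _ hm)
      · simp only [h, if_false]
        exact hp.notMem i (by omega) l hl
    · intro i hi l hl
      by_cases h : i = k
      · simp only [h, if_true]
        rw [hr l (by omega), hr (l + 1) hl]
        exact List.isChain_iff_getElem.1 hchain l (by omega)
      · simp only [h, if_false]
        exact hp.adj i (by omega) l hl
    · intro i hi l hl i' hi' l' hl' he
      by_cases h : i = k <;> by_cases h' : i' = k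
      · simp only [h, h', if_true] at he ⊢
        rw [hr l hl, hr l' hl', hnodup.getElem_inj_iff] at he
        exact ⟨trivial, he⟩
      · simp only [h, h', if_true, if_false] at he
        exact absurd he.symm (hrp l hl i' (by omega) l' hl')
      · simp only [h, h', if_true, if_false] at he
        exact absurd he (hrp l' hl' i (by omega) l hl)
      · simp only [h, h', if_false] at he
        exact hp.inj i (by omega) l hl i' (by omega) l' hl' he

/-! ### Linked paths and connectivity of the three layers -/

open Classical in
/-- If a relation on `[k] × [k]` has few pairs, then most rows contain fewer than `k / 2` of them. -/
theorem three_mul_le_card_sparse_rows {k : ℕ} (P : ℕ → ℕ → Prop)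
    (h : 8 * ((Finset.range k ×ˢ Finset.range k).filter fun x => P x.1 x.2).card < k ^ 2) :
    3 * k ≤ 4 * ((Finset.range k).filter fun i =>
      2 * ((Finset.range k).filter fun j => P i j).card < k).card := by
  have h1 : ((Finset.range k ×ˢ Finset.range k).filter fun x => P x.1 x.2).card =
      ∑ i ∈ Finset.range k, ((Finset.range k).filter fun j => P i j).card := by
    simp only [Finset.card_filter, Finset.sum_product]
  have h2 := Finset.card_filter_add_card_filter_not (s := Finset.range k)
    (fun i => 2 * ((Finset.range k).filter fun j => P i j).card < k)
  set b := ((Finset.range k).filter fun i =>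
      ¬ 2 * ((Finset.range k).filter fun j => P i j).card < k).card with hb
  have h3 : b * k ≤ ∑ i ∈ Finset.range k, 2 * ((Finset.range k).filter fun j => P i j).card := by
    refine le_trans ?_ (Finset.sum_le_sum_of_subset (Finset.filter_subset
      (fun i => ¬ 2 * ((Finset.range k).filter fun j => P i j).card < k) _))
    rw [hb, ← smul_eq_mul]
    exact Finset.card_nsmul_le_sum _ _ _ fun i hi => not_lt.1 (Finset.mem_filter.1 hi).2
  rw [← Finset.mul_sum, ← h1] at h3
  rw [Finset.card_range] at h2
  -- Each of the `b` dense rows holds at least `k / 2` of the fewer than `k² / 8` pairs.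
  have h4 : 4 * b < k := by
    by_contra hc
    have : k * k ≤ 4 * b * k := Nat.mul_le_mul_right _ (not_lt.1 hc)
    nlinarith
  omega

/-- No sample connects the last `m` nodes of the path `i` of `p` to the first `m` nodes of the path
`j` of `q`. -/
def Unlinked {n τ : ℕ} (σ : Fin n → Fin τ → Fin n) (L m : ℕ) (p q : ℕ → ℕ → Fin n) (i j : ℕ) :
    Prop :=
  ∀ l < L, L - m ≤ l → ∀ l' < m, ∀ x, σ (q j l') x ≠ p i l

open Classical in
/-- If, in both pairs of consecutive layers, few pairs of paths are unlinked, then most starting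
nodes in the first layer are connected to most end nodes in the third layer. -/
theorem exists_connected_sets {n τ : ℕ} {H : Digraph (Fin n)} (hH : IsAcyclic H) (ω : Samples n τ)
    (S : Finset (Fin 3 × Fin n)) {k L m : ℕ} (hm : 4 * m ≤ L) (p : Fin 3 → ℕ → ℕ → Fin n)
    (hp : ∀ a, IsPathFamily H (Finset.univ.filter fun x => (a, x) ∈ S) k L (p a))
    (h0 : 8 * ((Finset.range k ×ˢ Finset.range k).filter
      fun x => Unlinked (ω 0) L m (p 0) (p 1) x.1 x.2).card < k ^ 2)
    (h1 : 8 * ((Finset.range k ×ˢ Finset.range k).filter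
      fun x => Unlinked (ω 1) L m (p 1) (p 2) x.1 x.2).card < k ^ 2) :
    ∃ A B : Finset (Fin 3 × Fin n), (∀ u ∈ A, u.1 = 0) ∧ (∀ v ∈ B, v.1 = 2) ∧
      9 * (k * L) ≤ 16 * A.card ∧ 9 * (k * L) ≤ 16 * B.card ∧
      ∀ u ∈ A, ∀ v ∈ B, ConnectedAvoiding (threeLayer H ω) S u v := by
  set G := threeLayer H ω with hG
  let R : Fin 3 × Fin n → Fin 3 × Fin n → Prop := fun x y => G.Adj x y ∧ y ∉ S
  have hS : ∀ a, ∀ i < k, ∀ l < L, (a, p a i l) ∉ S := fun a i hi l hl => by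
    simpa using (hp a).notMem i hi l hl
  have along : ∀ a, ∀ i < k, ∀ l l', l ≤ l' → l' < L →
      Relation.ReflTransGen R (a, p a i l) (a, p a i l') := by
    intro a i hi l l' hll'
    induction l', hll' using Nat.le_induction with
    | base => exact fun _ => .refl
    | succ l' _ ih =>
      intro hl'
      exact (ih (by omega)).tail ⟨Or.inl ⟨rfl, (hp a).adj i hi l' hl'⟩, hS a i hi _ hl'⟩
  -- Transposed, so that rows are indexed by the paths of the third layer.
  have h1' : 8 * ((Finset.range k ×ˢ Finset.range k).filter
      fun x => Unlinked (ω 1) L m (p 1) (p 2) x.2 x.1).card < k ^ 2 := by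
    convert h1 using 2
    refine Finset.card_nbij' Prod.swap Prod.swap ?_ ?_ ?_ ?_ <;> simp +contextual [Set.MapsTo, Set.LeftInvOn]
  have r0 := three_mul_le_card_sparse_rows _ h0
  have r1 := three_mul_le_card_sparse_rows (fun i j => Unlinked (ω 1) L m (p 1) (p 2) j i) h1'
  set I := (Finset.range k).filter fun i => 2 * ((Finset.range k).filter
    fun j => Unlinked (ω 0) L m (p 0) (p 1) i j).card < k with hI
  set J := (Finset.range k).filter fun i => 2 * ((Finset.range k).filter
    fun j => Unlinked (ω 1) L m (p 1) (p 2) j i).card < k with hJ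
  have hIk : ∀ i ∈ I, i < k := fun i hi => Finset.mem_range.1 (Finset.mem_filter.1 hi).1
  have hJk : ∀ i ∈ J, i < k := fun i hi => Finset.mem_range.1 (Finset.mem_filter.1 hi).1
  refine ⟨(I ×ˢ Finset.range (L - m)).image fun x => (0, p 0 x.1 x.2),
    (J ×ˢ Finset.Ico m L).image fun x => (2, p 2 x.1 x.2), ?_, ?_, ?_, ?_, ?_⟩
  · simp +contextual [eq_comm]
  · simp +contextual [eq_comm]
  · rw [Finset.card_image_of_injOn, Finset.card_product, Finset.card_range]
    · have : 3 * L ≤ 4 * (L - m) := by omega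
      calc 9 * (k * L) = (3 * k) * (3 * L) := by ring
        _ ≤ (4 * I.card) * (4 * (L - m)) := Nat.mul_le_mul r0 this
        _ = _ := by ring
    · rintro ⟨i, l⟩ hx ⟨i', l'⟩ hx' he
      simp only [Finset.coe_product, Set.mem_prod, Finset.mem_coe, Finset.mem_range] at hx hx'
      have := (hp 0).inj i (hIk i hx.1) l (by omega) i' (hIk _ hx'.1) l' (by omega)
        (by simpa using he)
      simp [this]
  · rw [Finset.card_image_of_injOn, Finset.card_product, Nat.card_Ico]
    · have : 3 * L ≤ 4 * (L - m) := by omega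
      calc 9 * (k * L) = (3 * k) * (3 * L) := by ring
        _ ≤ (4 * J.card) * (4 * (L - m)) := Nat.mul_le_mul r1 this
        _ = _ := by ring
    · rintro ⟨i, l⟩ hx ⟨i', l'⟩ hx' he
      simp only [Finset.coe_product, Set.mem_prod, Finset.mem_coe, Finset.mem_Ico] at hx hx'
      have := (hp 2).inj i (hJk i hx.1) l (by omega) i' (hJk _ hx'.1) l' (by omega)
        (by simpa using he)
      simp [this]
  · intro u hu v hv
    obtain ⟨⟨i, l⟩, hx, rfl⟩ := Finset.mem_image.1 hu
    obtain ⟨⟨i', l'⟩, hy, rfl⟩ := Finset.mem_image.1 hv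
    simp only [Finset.mem_product, Finset.mem_range, Finset.mem_Ico] at hx hy
    have hi := hIk i hx.1
    have hi' := hJk i' hy.1
    have b0 := (Finset.mem_filter.1 hx.1).2
    have b1 := (Finset.mem_filter.1 hy.1).2
    -- Fewer than `k / 2` middle paths are unlinked to `i`, and fewer than `k / 2` to `i'`, so some
    -- `j` is linked to both.
    obtain ⟨j, hj, hj0, hj1⟩ : ∃ j < k, ¬ Unlinked (ω 0) L m (p 0) (p 1) i j ∧
        ¬ Unlinked (ω 1) L m (p 1) (p 2) j i' := by
      by_contra! hc
      have : (Finset.range k) ⊆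
          ((Finset.range k).filter fun j => Unlinked (ω 0) L m (p 0) (p 1) i j) ∪
          ((Finset.range k).filter fun j => Unlinked (ω 1) L m (p 1) (p 2) j i') := by
        intro j hj
        have := hc j (Finset.mem_range.1 hj)
        simp only [Finset.mem_union, Finset.mem_filter, hj, true_and]
        tauto
      have h2 := (Finset.card_le_card this).trans (Finset.card_union_le _ _)
      rw [Finset.card_range] at h2
      omega
    simp only [Unlinked, not_forall, not_not] at hj0 hj1
    obtain ⟨l1, hl1, hl1', l2, hl2, x, hxe⟩ := hj0
    obtain ⟨l3, hl3, hl3', l4, hl4, y, hye⟩ := hj1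
    refine connectedAvoiding_of_reflTransGen (isAcyclic_threeLayer hH ω) (hS 0 i hi l (by omega)) ?_
    refine (along 0 i hi l l1 (by omega) (by omega)).trans ?_
    refine .head ⟨Or.inr (Or.inl ⟨rfl, rfl, x, hxe⟩), hS 1 j hj l2 (by omega)⟩ ?_
    refine (along 1 j hj l2 l3 (by omega) (by omega)).trans ?_
    refine .head ⟨Or.inr (Or.inr ⟨rfl, rfl, y, hye⟩), hS 2 i' hi' l4 (by omega)⟩ ?_
    exact along 2 i' hi' l4 l' (by omega) (by omega)

/-! ### Failure probability of the random connections -/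

open Classical in
/-- The pairs joining linked ends of `m` nodes of disjoint paths number `m ^ 2` per pair of paths. -/
theorem card_mul_sq_le_sum_card {V : Type*} [Fintype V] {G : Digraph V} {S S' : Finset V}
    {k L m : ℕ} (hm : m ≤ L) {p q : ℕ → ℕ → V} (hp : IsPathFamily G S k L p)
    (hq : IsPathFamily G S' k L q) (E : Finset (ℕ × ℕ))
    (hE : E ⊆ Finset.range k ×ˢ Finset.range k) :
    E.card * m ^ 2 ≤ ∑ y, (Finset.univ.filter fun x => ∃ e ∈ E, ∃ l < L, L - m ≤ l ∧ ∃ l' < m,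
      y = q e.2 l' ∧ x = p e.1 l).card := by
  rw [← Finset.card_sigma]
  have : E.card * m ^ 2 = (E ×ˢ Finset.range m ×ˢ Finset.Ico (L - m) L).card := by
    simp only [Finset.card_product, Finset.card_range, Nat.card_Ico]
    rw [Nat.sub_sub_self hm]; ring
  rw [this]
  -- By disjointness, a pair of nodes determines both paths and both positions.
  refine Finset.card_le_card_of_injOn (fun x => ⟨q x.1.2 x.2.1, p x.1.1 x.2.2⟩) ?_ ?_
  · rintro ⟨⟨i, j⟩, l', l⟩ hx
    simp only [Finset.coe_product, Set.mem_prod, Finset.mem_coe, Finset.mem_range,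
      Finset.mem_Ico] at hx
    simp only [Finset.coe_sigma, Set.mem_sigma_iff, Finset.mem_coe, Finset.mem_filter,
      Finset.mem_univ, true_and]
    exact ⟨(i, j), hx.1, l, hx.2.2.2, hx.2.2.1, l', hx.2.1, rfl, rfl⟩
  · rintro ⟨⟨i, j⟩, l', l⟩ hx ⟨⟨i', j'⟩, r', r⟩ hy he
    simp only [Finset.coe_product, Set.mem_prod, Finset.mem_coe, Finset.mem_range,
      Finset.mem_Ico] at hx hy
    have h1 := hE hx.1
    have h2 := hE hy.1
    simp only [Finset.mem_product, Finset.mem_range] at h1 h2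
    simp only [Sigma.mk.injEq, heq_eq_eq] at he
    have e1 := hq.inj j h1.2 l' (by omega) j' h2.2 r' (by omega) he.1
    have e2 := hp.inj i h1.1 l (by omega) i' h2.1 r (by omega) he.2
    simp [e1, e2]

/-- Take `L = ⌈n^(2/3)⌉` and `k = ⌊cn/(2L)⌋ + 1`: the paths cover `c n / 2` nodes, but before the
last one is chosen at most that many have been used, so the budget holds. The bound `k ^ 2 ≤ n`
keeps the number of sets of path pairs below `2 ^ n`, and `4 ≤ L` makes the end blocks nonempty. -/
theorem exists_length_and_number_of_paths {n : ℕ} {c : ℝ} (hc : 0 < c) (hc1 : c < 1) (hn : 8 ≤ n) :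
    ∃ L k : ℕ, 4 ≤ L ∧ (L : ℝ) < (n : ℝ) ^ (2 / 3 : ℝ) + 1 ∧ c * n / 2 ≤ (k * L : ℕ) ∧
      k ^ 2 ≤ n ∧ ∀ j < k, c * n / 2 + j * L ≤ c * n := by
  have hn0 : (0 : ℝ) < n := by exact_mod_cast (by omega : 0 < n)
  set d : ℝ := (n : ℝ) ^ (2 / 3 : ℝ) with hd
  have hd0 : 0 ≤ d := by positivity
  have hd3 : d ^ 3 = (n : ℝ) ^ 2 := by
    rw [hd, ← Real.rpow_natCast, ← Real.rpow_mul hn0.le, ← Real.rpow_natCast]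
    norm_num
  set L := ⌈d⌉₊ with hL
  have hLd : d ≤ L := Nat.le_ceil d
  have hLd' : (L : ℝ) < d + 1 := Nat.ceil_lt_add_one hd0
  have hL3 : n ^ 2 ≤ L ^ 3 := by
    have : (n : ℝ) ^ 2 ≤ (L : ℝ) ^ 3 := hd3 ▸ pow_le_pow_left₀ hd0 hLd 3
    exact_mod_cast this
  have hL4 : 4 ≤ L := by
    by_contra hlt
    have h1 : L ^ 3 ≤ 3 ^ 3 := Nat.pow_le_pow_left (by omega) 3
    have h2 : 8 ^ 2 ≤ n ^ 2 := Nat.pow_le_pow_left hn 2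
    omega
  have hL0 : (0 : ℝ) < L := by exact_mod_cast (by omega : 0 < L)
  set q := ⌊c * n / (2 * L)⌋₊ with hq
  have hq1 : (q : ℝ) ≤ c * n / (2 * L) := Nat.floor_le (by positivity)
  have hq2 : c * n / (2 * L) < q + 1 := Nat.lt_floor_add_one _
  rw [le_div_iff₀ (by positivity)] at hq1
  rw [div_lt_iff₀ (by positivity)] at hq2
  set k := q + 1 with hk
  have hkL : c * n / 2 ≤ (k * L : ℕ) := by push_cast [hk]; linarith
  have hkn : k ^ 2 ≤ n := by
    have h1 : q * (2 * L) ≤ n := by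
      have : (q : ℝ) * (2 * L) ≤ n := hq1.trans (by nlinarith)
      exact_mod_cast this
    -- Cube `2 q L ≤ n` and use `L³ ≥ n²`.
    have h2 : 8 * q ^ 3 ≤ n := by
      have h3 := Nat.pow_le_pow_left h1 3
      have h4 : 8 * q ^ 3 * n ^ 2 ≤ n * n ^ 2 := by
        calc 8 * q ^ 3 * n ^ 2 ≤ 8 * q ^ 3 * L ^ 3 := Nat.mul_le_mul_left _ hL3
          _ = (q * (2 * L)) ^ 3 := by ring
          _ ≤ n ^ 3 := h3
          _ = _ := by ring
      exact Nat.le_of_mul_le_mul_right h4 (by positivity)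
    rcases Nat.eq_zero_or_pos q with h | h
    · rw [hk, h]; omega
    · rw [hk]; nlinarith [Nat.mul_le_mul h h, Nat.mul_le_mul (Nat.mul_le_mul h h) h,
        Nat.mul_le_mul_right (q * q) h]
  refine ⟨L, k, hL4, hLd', hkL, hkn, fun j hj => ?_⟩
  have : (j : ℝ) ≤ q := by exact_mod_cast (by omega : j ≤ q)
  nlinarith

-- A bad event is given by the traces of `S` on two layers, a set `E` of at least `k² / 8` unlinked
-- pairs of paths, and one of the two passages. Avoiding all of these events handles every `S` at
-- once.
open Classical in
theorem card_not_robustlyConnected_le_of_large {n τ : ℕ} {c : ℝ} (hc : 0 < c) (hc1 : c < 1)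
    (hn : 8 ≤ n) {H : Digraph (Fin n)} (hH : IsAcyclic H)
    (hR : DepthRobust H (c * n) ((n : ℝ) ^ (2 / 3 : ℝ))) :
    ({ω : Samples n τ | ¬ RobustlyConnected c (threeLayer H ω)}.ncard : ℝ) ≤
      2 ^ (4 * n) * (Nat.card (Samples n τ) * Real.exp (-(τ * (c ^ 2 * n / 2048)))) := by
  have : NeZero n := ⟨by omega⟩
  obtain ⟨L, k, hL4, hL, hkL, hkn, hjL⟩ := exists_length_and_number_of_paths hc hc1 hn
  have hex : ∀ S : Finset (Fin n), (S.card : ℝ) ≤ c * n / 2 → ∃ p, IsPathFamily H S k L p :=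
    fun S hS => hR.exists_isPathFamily hL S k fun j hj => by linarith [hjL j hj]
  -- One path family is fixed for each trace, before the samples are drawn.
  choose! P hP using hex
  obtain ⟨m, hm, hm'⟩ : ∃ m, 4 * m ≤ L ∧ L ≤ 8 * m := ⟨L / 4, by omega, by omega⟩
  let T : (Finset (Fin n) × Finset (Fin n)) × Finset (ℕ × ℕ) × Fin 2 → Fin 2 → Fin n →
    Finset (Fin n) := fun d a y => if a = d.2.2 then Finset.univ.filter fun x => ∃ e ∈ d.2.1,
      ∃ l < L, L - m ≤ l ∧ ∃ l' < m, y = P d.1.2 e.2 l' ∧ x = P d.1.1 e.1 l else ∅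
  let 𝒮 : Finset (Finset (Fin n)) := Finset.univ.filter fun S => (S.card : ℝ) ≤ c * n / 2
  let Δ : Finset ((Finset (Fin n) × Finset (Fin n)) × Finset (ℕ × ℕ) × Fin 2) :=
    (𝒮 ×ˢ 𝒮) ×ˢ ((Finset.range k ×ˢ Finset.range k).powerset.filter fun E => k ^ 2 ≤ 8 * E.card) ×ˢ
      Finset.univ
  have hΔ : (Δ.card : ℝ) ≤ 2 ^ (4 * n) := by
    have h1 : 𝒮.card ≤ 2 ^ n := (Finset.card_filter_le _ _).trans (by simp)
    have h2 : ((Finset.range k ×ˢ Finset.range k).powerset.filter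
        fun E => k ^ 2 ≤ 8 * E.card).card ≤ 2 ^ n := by
      refine (Finset.card_filter_le _ _).trans ?_
      rw [Finset.card_powerset, Finset.card_product, Finset.card_range, ← sq]
      exact Nat.pow_le_pow_right (by norm_num) hkn
    have h3 : 2 ≤ 2 ^ n := Nat.le_self_pow (by omega) 2
    have : Δ.card ≤ 2 ^ (4 * n) := by
      simp only [Δ, Finset.card_product, Finset.card_univ, Fintype.card_fin]
      calc _ ≤ (2 ^ n * 2 ^ n) * (2 ^ n * 2 ^ n) := by gcongr
        _ = _ := by rw [← pow_add, ← pow_add]; congr 1; ring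
    exact_mod_cast this
  -- The constant comes from `|E| ≥ k²/8`, `m ≥ L/8` and `k L ≥ cn/2`: `|E| m² ≥ (kL)²/512 ≥
  -- c²n²/2048`.
  have hσ : ∀ d ∈ Δ, c ^ 2 * n / 2048 * Fintype.card (Fin n) ≤
      ∑ a, ∑ y, ((T d a y).card : ℝ) := by
    rintro ⟨⟨S, S'⟩, E, a⟩ hd
    simp only [Δ, 𝒮, Finset.mem_product, Finset.mem_filter, Finset.mem_univ, true_and, and_true,
      Finset.mem_powerset] at hd
    have h1 := card_mul_sq_le_sum_card (show m ≤ L by omega) (hP S hd.1.1) (hP S' hd.1.2) E hd.2.1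
    have h2 : (k * L) ^ 2 ≤ 512 * (E.card * m ^ 2) := by
      calc (k * L) ^ 2 = k ^ 2 * L ^ 2 := by ring
        _ ≤ (8 * E.card) * (8 * m) ^ 2 := Nat.mul_le_mul hd.2.2 (Nat.pow_le_pow_left hm' 2)
        _ = _ := by ring
    have h3 : (c * n / 2) ^ 2 ≤ ((k * L : ℕ) : ℝ) ^ 2 := pow_le_pow_left₀ (by positivity) hkL 2
    have h4 : (((k * L : ℕ) : ℝ)) ^ 2 ≤ 512 * ((E.card : ℝ) * m ^ 2) := by exact_mod_cast h2
    rw [Fintype.card_fin]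
    calc c ^ 2 * n / 2048 * n ≤ (E.card : ℝ) * m ^ 2 := by nlinarith
      _ ≤ ∑ y, ((T ((S, S'), E, a) a y).card : ℝ) := by
          simp only [T, if_true]
          refine le_trans (Nat.cast_le (α := ℝ).2 h1) (le_of_eq ?_) |>.trans' (by push_cast; rfl)
          push_cast
          congr!
      _ ≤ _ := Finset.single_le_sum (f := fun a' => ∑ y, ((T ((S, S'), E, a) a' y).card : ℝ))
          (fun _ _ => Finset.sum_nonneg fun _ _ => Nat.cast_nonneg _) (Finset.mem_univ a)
  refine le_trans ?_ ((card_exists_avoiding_le τ Δ T (c ^ 2 * n / 2048) hσ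
    (by simp; omega)).trans (mul_le_mul_of_nonneg_right hΔ (by positivity)))
  rw [Nat.cast_le]
  refine Set.ncard_le_ncard (fun ω hω => ?_) (Set.toFinite _)
  simp only [Set.mem_ofPred_eq] at hω ⊢
  by_contra hno
  push Not at hno
  refine hω fun S hS => ?_
  let Q : Fin 3 → Finset (Fin n) := fun a => Finset.univ.filter fun x => (a, x) ∈ S
  have hQ : ∀ a, ((Q a).card : ℝ) ≤ c * n / 2 := by
    intro a
    refine le_trans ?_ hS
    rw [Nat.cast_le]
    refine Finset.card_le_card_of_injOn (fun x => (a, x)) (fun x hx => ?_) fun x _ y _ h => ?_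
    · simpa [Q] using hx
    · simpa using h
  have few : ∀ a : Fin 2, ∀ b b' : Fin 3, 8 * ((Finset.range k ×ˢ Finset.range k).filter
      fun x => Unlinked (ω a) L m (P (Q b)) (P (Q b')) x.1 x.2).card < k ^ 2 := by
    intro a b b'
    by_contra! hlt
    obtain ⟨a', y, x, hx⟩ := hno ((Q b, Q b'), (Finset.range k ×ˢ Finset.range k).filter
      (fun x => Unlinked (ω a) L m (P (Q b)) (P (Q b')) x.1 x.2), a) (by
        simp only [Δ, 𝒮, Finset.mem_product, Finset.mem_filter, Finset.mem_univ, true_and,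
          and_true, Finset.mem_powerset]
        exact ⟨⟨hQ b, hQ b'⟩, Finset.filter_subset _ _, hlt⟩)
    simp only [T] at hx
    split_ifs at hx with haa
    · simp only [Finset.mem_filter, Finset.mem_univ, true_and] at hx
      obtain ⟨e, he, l, hl, hl', l', hl'', rfl, hxe⟩ := hx
      subst haa
      exact he.2 l hl hl' l' hl'' x hxe
    · simp at hx
  obtain ⟨A, B, hA, hB, hAc, hBc, hAB⟩ := exists_connected_sets hH ω S hm
    (fun a => P (Q a)) (fun a => hP _ (hQ a)) (few 0 0 1) (few 1 1 2)
  have size : ∀ C : Finset (Fin 3 × Fin n), 9 * (k * L) ≤ 16 * C.card →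
      9 * c * n / 40 ≤ (C.card : ℝ) := by
    intro C hC
    have : (9 : ℝ) * (k * L : ℕ) ≤ 16 * C.card := by exact_mod_cast hC
    have : 0 < c * n := by positivity
    linarith
  exact ⟨A, B, hA, hB, size A hAc, size B hBc, hAB⟩

-- Serves `n < 8`, where paths may be too short for end blocks. If every node samples the whole
-- previous layer, one surviving middle node joins all survivors of the outer layers; as `c < 1`,
-- more than `n / 2` nodes survive in each layer.
open Classical in
theorem card_not_robustlyConnected_le_of_complete {n τ : ℕ} {c : ℝ} (hc1 : c < 1)
    (hn : 0 < n) {H : Digraph (Fin n)} (hH : IsAcyclic H) :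
    ({ω : Samples n τ | ¬ RobustlyConnected c (threeLayer H ω)}.ncard : ℝ) ≤
      (2 * n ^ 2 : ℕ) * (Nat.card (Samples n τ) * Real.exp (-(τ * (1 / n)))) := by
  have hn0 : (0 : ℝ) < n := by exact_mod_cast hn
  let T : Fin 2 × Fin n × Fin n → Fin 2 → Fin n → Finset (Fin n) := fun d a y =>
    if a = d.1 then if y = d.2.2 then {d.2.1} else ∅ else ∅
  have hσ : ∀ d ∈ (Finset.univ : Finset (Fin 2 × Fin n × Fin n)),
      1 / (n : ℝ) * Fintype.card (Fin n) ≤ ∑ a, ∑ y, ((T d a y).card : ℝ) := by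
    rintro ⟨a, x, y⟩ -
    rw [Fintype.card_fin, one_div, inv_mul_cancel₀ hn0.ne']
    calc (1 : ℝ) = ((T (a, x, y) a y).card : ℝ) := by simp [T]
      _ ≤ ∑ y', ((T (a, x, y) a y').card : ℝ) :=
          Finset.single_le_sum (f := fun y' => ((T (a, x, y) a y').card : ℝ))
            (fun _ _ => Nat.cast_nonneg _) (Finset.mem_univ y)
      _ ≤ _ := Finset.single_le_sum (f := fun a' => ∑ y', ((T (a, x, y) a' y').card : ℝ))
          (fun _ _ => Finset.sum_nonneg fun _ _ => Nat.cast_nonneg _) (Finset.mem_univ a)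
  have hD : (Finset.univ : Finset (Fin 2 × Fin n × Fin n)).card = 2 * n ^ 2 := by
    rw [Finset.card_univ, Fintype.card_prod, Fintype.card_prod, Fintype.card_fin,
      Fintype.card_fin, sq]
  have hcard := card_exists_avoiding_le τ Finset.univ T (1 / n) hσ (by simpa using hn)
  rw [hD] at hcard
  refine le_trans ?_ hcard
  rw [Nat.cast_le]
  refine Set.ncard_le_ncard (fun ω hω => ?_) (Set.toFinite _)
  simp only [Set.mem_ofPred_eq] at hω ⊢
  by_contra hno
  push Not at hno
  have hall : ∀ a x y, ∃ i, ω a y i = x := by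
    intro a x y
    obtain ⟨a', y', i, hi⟩ := hno (a, x, y) (Finset.mem_univ _)
    simp only [T] at hi
    split_ifs at hi with h1 h2
    · subst h1 h2
      exact ⟨i, by simpa using hi⟩
    · simp at hi
    · simp at hi
  refine hω fun S hS => ?_
  let F : Fin 3 → Finset (Fin 3 × Fin n) := fun a => (Finset.univ.image fun x => (a, x)) \ S
  have hF : ∀ a, (n : ℝ) / 2 < (F a).card := by
    intro a
    have h1 : n ≤ (F a).card + S.card := by
      have := Finset.le_card_sdiff S (Finset.univ.image fun x : Fin n => (a, x))
      rw [Finset.card_image_of_injective _ (Prod.mk_right_injective a), Finset.card_univ,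
        Fintype.card_fin] at this
      simp only [F]
      omega
    have h2 : (n : ℝ) ≤ (F a).card + S.card := by exact_mod_cast h1
    nlinarith
  have hmem : ∀ a, ∀ u ∈ F a, u.1 = a ∧ u ∉ S := by
    intro a u hu
    simp only [F, Finset.mem_sdiff, Finset.mem_image, Finset.mem_univ, true_and] at hu
    obtain ⟨⟨x, rfl⟩, h⟩ := hu
    exact ⟨rfl, h⟩
  refine ⟨F 0, F 2, fun u hu => (hmem 0 u hu).1, fun u hu => (hmem 2 u hu).1, ?_, ?_, ?_⟩
  · have := hF 0
    nlinarith
  · have := hF 2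
    nlinarith
  · rintro ⟨a, x⟩ hu ⟨b, y⟩ hv
    obtain ⟨rfl, hu⟩ := hmem _ _ hu
    obtain ⟨rfl, hv⟩ := hmem _ _ hv
    have h1 : 0 < (F 1).card := by
      have h2 : (0 : ℝ) < (F 1).card := lt_trans (by positivity) (hF 1)
      exact_mod_cast h2
    obtain ⟨⟨b, z⟩, hw⟩ := Finset.card_pos.1 h1
    obtain ⟨rfl, hz⟩ := hmem _ _ hw
    refine connectedAvoiding_of_reflTransGen (isAcyclic_threeLayer hH ω) hu ?_
    exact .head (b := (1, z)) ⟨Or.inr (Or.inl ⟨rfl, rfl, hall 0 x z⟩), hz⟩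
      (.single ⟨Or.inr (Or.inr ⟨rfl, rfl, hall 1 z y⟩), hv⟩)

/-! ### From counting to probability -/

open Classical in
theorem one_sub_le_real_uniformOn_univ {Ω : Type*} [Fintype Ω] [Nonempty Ω] [MeasurableSpace Ω]
    [MeasurableSingletonClass Ω] (P : Ω → Prop) (ε : ℝ)
    (h : ({ω | ¬ P ω}.ncard : ℝ) ≤ ε * Nat.card Ω) :
    1 - ε ≤ (ProbabilityTheory.uniformOn (Set.univ : Set Ω)).real {ω | P ω} := by
  have h0 : {ω | ¬ P ω} = ((Finset.univ.filter fun ω => ¬ P ω : Finset Ω) : Set Ω) := by simp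
  rw [h0, Set.ncard_coe_finset, Nat.card_eq_fintype_card] at h
  have hpos : (0 : ℝ) < Fintype.card Ω := by exact_mod_cast Fintype.card_pos
  have h1 : (Finset.univ.filter fun ω => P ω).card + (Finset.univ.filter fun ω => ¬ P ω).card =
      Fintype.card Ω := Finset.card_filter_add_card_filter_not _
  have h2 : ((Finset.univ.filter fun ω => P ω).card : ℝ) +
      (Finset.univ.filter fun ω => ¬ P ω).card = Fintype.card Ω := by exact_mod_cast h1
  have h3 : {ω | P ω} = ((Finset.univ.filter fun ω => P ω : Finset Ω) : Set Ω) := by simp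
  rw [MeasureTheory.measureReal_def, ProbabilityTheory.uniformOn_univ, h3,
    MeasureTheory.Measure.count_apply_finset, ENNReal.toReal_div, ENNReal.toReal_natCast,
    ENNReal.toReal_natCast, le_div_iff₀ hpos]
  linarith

theorem exists_robustlyConnected_of_isDepthRobustFamily (c : ℝ) (hc : 0 < c) :
    ∃ τ₀ : ℕ, ∀ τ : ℕ, τ₀ ≤ τ →
      ∀ (δ : ℕ) (H : (n : ℕ) → Digraph (Fin n)), IsDepthRobustFamily c δ H →
        ∀ n : ℕ, 1 ≤ n →
          1 - (2 : ℝ)⁻¹ ^ n ≤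
            (ProbabilityTheory.uniformOn (Set.univ : Set (Samples n τ))).real
              {ω | RobustlyConnected c (threeLayer (H n) ω)} := by
  -- `12288 = 6 · 2048` turns the exponential factor into at most `exp(-6n)`, which beats the
  -- `2^(4n)` events.
  refine ⟨⌈12288 / c ^ 2⌉₊, fun τ hτ δ H hH n hn => ?_⟩
  have hτ' : 12288 / c ^ 2 ≤ (τ : ℝ) := Nat.ceil_le.1 hτ
  -- If `c ≥ 1`, the only node of `H 1` could be deleted, leaving no path.
  have hc1 : c < 1 := by
    by_contra! hge
    obtain ⟨l, ⟨hl, -, -, hS⟩, -⟩ := (hH 1 le_rfl).2.2 Finset.univ (by simpa using hge)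
    obtain ⟨x, hx⟩ := List.exists_mem_of_ne_nil l hl
    exact hS x hx (Finset.mem_univ x)
  rw [div_le_iff₀ (by positivity)] at hτ'
  obtain ⟨hac, -, hR⟩ := hH n hn
  have : NeZero n := ⟨by omega⟩
  have hn0 : (0 : ℝ) < n := by exact_mod_cast hn
  have hlog : Real.log 2 < 1 := by linarith [Real.log_two_lt_d9]
  have hexp : Real.exp (-(6 * n : ℝ)) ≤ (2 : ℝ)⁻¹ ^ (6 * n) := by
    rw [← Real.exp_log (show (0 : ℝ) < 2⁻¹ by norm_num), ← Real.exp_nat_mul, Real.log_inv]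
    apply Real.exp_le_exp.2
    push_cast
    nlinarith
  have hpow : (2 : ℝ) ^ (4 * n) * (2 : ℝ)⁻¹ ^ (6 * n) ≤ (2 : ℝ)⁻¹ ^ n := by
    have h1 : (2 : ℝ) ^ (4 * n) * (2 : ℝ)⁻¹ ^ (6 * n) = (2 : ℝ)⁻¹ ^ (2 * n) := by
      rw [show 6 * n = 4 * n + 2 * n by ring, pow_add, ← mul_assoc, ← mul_pow]
      norm_num
    rw [h1]
    exact pow_le_pow_of_le_one (by norm_num) (by norm_num) (by omega)
  refine one_sub_le_real_uniformOn_univ _ _ ?_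
  rcases le_or_gt 8 n with h8 | h8
  · refine (card_not_robustlyConnected_le_of_large hc hc1 h8 hac hR).trans ?_
    have : Real.exp (-(τ * (c ^ 2 * n / 2048))) ≤ Real.exp (-(6 * n : ℝ)) := by
      apply Real.exp_le_exp.2
      nlinarith
    calc _ = (2 ^ (4 * n) * Real.exp (-(τ * (c ^ 2 * n / 2048)))) *
          Nat.card (Samples n τ) := by ring
      _ ≤ _ := by
        gcongr
        refine le_trans ?_ hpow
        gcongr
        exact this.trans hexp
  · refine (card_not_robustlyConnected_le_of_complete hc1 (by omega) hac).trans ?_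
    have hcc : c ^ 2 ≤ 1 := by nlinarith
    have hn8 : (n : ℝ) < 8 := by exact_mod_cast h8
    have : Real.exp (-(τ * (1 / n))) ≤ Real.exp (-(6 * n : ℝ)) := by
      apply Real.exp_le_exp.2
      rw [neg_le_neg_iff, mul_one_div, le_div_iff₀ hn0]
      nlinarith
    have h2 : ((2 * n ^ 2 : ℕ) : ℝ) ≤ 2 ^ (4 * n) := by
      have h3 : 2 * n ^ 2 ≤ 2 ^ (4 * n) := by
        have h4 : n < 2 ^ n := Nat.lt_two_pow_self
        have h5 : 2 ≤ 2 ^ n := Nat.le_self_pow (by omega) 2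
        calc 2 * n ^ 2 ≤ 2 ^ n * (2 ^ n) ^ 2 := by gcongr
          _ = 2 ^ (3 * n) := by ring
          _ ≤ _ := Nat.pow_le_pow_right (by norm_num) (by omega)
      exact_mod_cast h3
    calc _ = (((2 * n ^ 2 : ℕ) : ℝ) * Real.exp (-(τ * (1 / n)))) *
          Nat.card (Samples n τ) := by ring
      _ ≤ _ := by
        gcongr
        refine le_trans ?_ hpow
        gcongr
        exact this.trans hexp

/-! ### Entropy of labellings and inversions -/

theorem log_one_add_sq_le {y : ℝ} (hy : 0 ≤ y) : Real.log (1 + y ^ 2) ≤ y := by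
  rw [Real.log_le_iff_le_exp (by positivity)]
  have h := Real.sum_le_exp_of_nonneg hy 4
  simp only [Finset.sum_range_succ, Finset.sum_range_zero, Nat.factorial] at h
  norm_num at h
  nlinarith [mul_nonneg hy (sq_nonneg (y - 3 / 2))]

theorem log_one_add_le {x μ : ℝ} (hx : 0 ≤ x) (hμ : 0 < μ) :
    Real.log (1 + x) ≤ (μ + x / μ) / 2 := by
  have h1 := log_one_add_sq_le (Real.sqrt_nonneg x)
  rw [Real.sq_sqrt hx] at h1
  refine h1.trans ?_
  have h2 : x / μ = √x ^ 2 / μ := by rw [Real.sq_sqrt hx]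
  rw [h2, le_div_iff₀ two_pos, ← sub_nonneg]
  have : μ + √x ^ 2 / μ - √x * 2 = (μ - √x) ^ 2 / μ := by field_simp; ring
  rw [this]
  positivity

/-- The excess is `a log(1 + b/a) + b log(1 + a/b) ≤ 2√(ab) ≤ μa + b/μ`, by `log(1 + x) ≤ √x`. A
small `μ` suits `b` much smaller than `a`, a large one the opposite. -/
theorem mul_log_add_le {a b μ : ℝ} (ha : 0 ≤ a) (hb : 0 ≤ b) (hμ : 0 < μ) :
    (a + b) * Real.log (a + b) ≤ a * Real.log a + b * Real.log b + (μ * a + b / μ) := by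
  rcases ha.eq_or_lt with rfl | ha
  · have : 0 ≤ b / μ := by positivity
    simpa using this
  rcases hb.eq_or_lt with rfl | hb
  · have : 0 ≤ μ * a := by positivity
    simpa using this
  have h1 : Real.log (a + b) = Real.log a + Real.log (1 + b / a) := by
    rw [← Real.log_mul (by positivity) (by positivity)]; congr 1; field_simp
  have h2 : Real.log (a + b) = Real.log b + Real.log (1 + a / b) := by
    rw [← Real.log_mul (by positivity) (by positivity)]; congr 1; field_simp; ring
  have h3 := mul_le_mul_of_nonneg_left (log_one_add_le (by positivity : 0 ≤ b / a) hμ) ha.le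
  have h4 := mul_le_mul_of_nonneg_left
    (log_one_add_le (by positivity : 0 ≤ a / b) (inv_pos.2 hμ)) hb.le
  have h5 : a * ((μ + b / a / μ) / 2) = (μ * a + b / μ) / 2 := by field_simp
  have h6 : b * ((μ⁻¹ + a / b / μ⁻¹) / 2) = (μ * a + b / μ) / 2 := by field_simp; ring
  rw [h5] at h3
  rw [h6] at h4
  calc (a + b) * Real.log (a + b) = a * Real.log (a + b) + b * Real.log (a + b) := by ring
    _ = a * (Real.log a + Real.log (1 + b / a)) + b * (Real.log b + Real.log (1 + a / b)) := by
        rw [← h1, ← h2]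
    _ ≤ _ := by linarith

/-- The sum of `m log m` over the sizes `m` of the classes of `I` on which `θ` is constant. -/
noncomputable def labelEntropy {α : Type*} (θ : α → ℕ) (d : ℕ) (I : Finset α) : ℝ :=
  ∑ s ∈ Finset.range d, ((I.filter fun x => θ x = s).card : ℝ) *
    Real.log ((I.filter fun x => θ x = s).card : ℝ)

/-- If most pairs in `A × B` are strictly increasing with respect to `θ`, the label classes of `A`
and `B` hardly overlap, and `labelEntropy` is almost additive. -/
theorem labelEntropy_union_le {α : Type*} [DecidableEq α] (θ : α → ℕ) (d : ℕ) {A B : Finset α}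
    (hAB : Disjoint A B) {M μ : ℝ} (hM : 0 < M) (hμ : 0 < μ) (hA : (A.card : ℝ) ≤ M)
    (hB : (B.card : ℝ) ≤ M) :
    labelEntropy θ d (A ∪ B) ≤ labelEntropy θ d A + labelEntropy θ d B + 3 * μ * M +
      (∑ v ∈ B, ((A.filter fun w => θ v ≤ θ w).card : ℝ)) / (μ ^ 3 * M) := by
  set a : ℕ → ℝ := fun s => ((A.filter fun x => θ x = s).card : ℝ) with ha
  set b : ℕ → ℝ := fun s => ((B.filter fun x => θ x = s).card : ℝ) with hb
  have hcount : ∀ (C : Finset α) (D : Finset ℕ), ∑ s ∈ D, ((C.filter fun x => θ x = s).card : ℝ) =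
      ((C.filter fun x => θ x ∈ D).card : ℝ) := by
    intro C D
    rw [Finset.card_eq_sum_card_fiberwise (s := C.filter fun x => θ x ∈ D) (f := θ) (t := D)
      (fun x hx => (Finset.mem_filter.1 hx).2)]
    push_cast
    refine Finset.sum_congr rfl fun s hs => ?_
    rw [Finset.filter_filter]
    congr 2
    ext x
    constructor <;> intro h <;> simp_all
  have hadd : ∀ s, (((A ∪ B).filter fun x => θ x = s).card : ℝ) = a s + b s := by
    intro s
    rw [Finset.filter_union, Finset.card_union_of_disjoint
      (Finset.disjoint_filter_filter hAB)]
    push_cast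
    rfl
  set up : ℕ → ℝ := fun s => ((A.filter fun w => s ≤ θ w).card : ℝ) with hup
  -- Low labels are those that more than `μ² M` elements of `A` reach or exceed. Each element of `B`
  -- with a low label causes that many inversions, so few such elements exist; and at most `μ² M`
  -- elements of `A` have high labels. `mul_log_add_le` is then used with `μ` on `Lo` and `μ⁻¹` on
  -- `Hi`.
  set Lo := (Finset.range d).filter fun s => μ ^ 2 * M < up s with hLo
  set Hi := (Finset.range d).filter fun s => ¬ μ ^ 2 * M < up s with hHi
  have hsplit : ∀ f : ℕ → ℝ, ∑ s ∈ Finset.range d, f s = ∑ s ∈ Lo, f s + ∑ s ∈ Hi, f s :=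
    fun f => (Finset.sum_filter_add_sum_filter_not _ _ _).symm
  have haM : ∀ D, ∑ s ∈ D, a s ≤ M := fun D => by
    rw [ha, hcount]
    exact (Nat.cast_le.2 (Finset.card_filter_le _ _)).trans hA
  have hbM : ∀ D, ∑ s ∈ D, b s ≤ M := fun D => by
    rw [hb, hcount]
    exact (Nat.cast_le.2 (Finset.card_filter_le _ _)).trans hB
  have hHiA : ∑ s ∈ Hi, a s ≤ μ ^ 2 * M := by
    rcases Hi.eq_empty_or_nonempty with h | h
    · rw [h, Finset.sum_empty]; positivity
    · have h1 := Finset.min'_mem Hi h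
      rw [ha, hcount]
      refine le_trans ?_ (not_lt.1 (Finset.mem_filter.1 h1).2)
      rw [hup, Nat.cast_le]
      refine Finset.card_le_card fun w hw => ?_
      rw [Finset.mem_filter] at hw ⊢
      exact ⟨hw.1, Finset.min'_le _ _ hw.2⟩
  have hLoB : μ ^ 2 * M * ∑ s ∈ Lo, b s ≤ ∑ v ∈ B, up (θ v) := by
    rw [hb, hcount]
    calc _ = ∑ v ∈ B.filter fun x => θ x ∈ Lo, μ ^ 2 * M := by
          rw [Finset.sum_const, nsmul_eq_mul, mul_comm]
      _ ≤ ∑ v ∈ B.filter fun x => θ x ∈ Lo, up (θ v) :=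
          Finset.sum_le_sum fun v hv =>
            (Finset.mem_filter.1 (Finset.mem_filter.1 hv).2).2.le
      _ ≤ _ := Finset.sum_le_sum_of_subset_of_nonneg (Finset.filter_subset _ _)
          fun _ _ _ => Nat.cast_nonneg _
  have key : ∀ s, ∀ ν : ℝ, 0 < ν → (a s + b s) * Real.log (a s + b s) ≤
      a s * Real.log (a s) + b s * Real.log (b s) + (ν * a s + b s / ν) := fun s ν hν =>
    mul_log_add_le (Nat.cast_nonneg _) (Nat.cast_nonneg _) hν
  have h1 : ∑ s ∈ Lo, (a s + b s) * Real.log (a s + b s) ≤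
      ∑ s ∈ Lo, (a s * Real.log (a s) + b s * Real.log (b s)) +
        (μ * ∑ s ∈ Lo, a s + (∑ s ∈ Lo, b s) / μ) := by
    rw [Finset.mul_sum, Finset.sum_div, ← Finset.sum_add_distrib, ← Finset.sum_add_distrib]
    exact Finset.sum_le_sum fun s _ => key s μ hμ
  have h2 : ∑ s ∈ Hi, (a s + b s) * Real.log (a s + b s) ≤
      ∑ s ∈ Hi, (a s * Real.log (a s) + b s * Real.log (b s)) +
        (μ⁻¹ * ∑ s ∈ Hi, a s + (∑ s ∈ Hi, b s) / μ⁻¹) := by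
    rw [Finset.mul_sum, Finset.sum_div, ← Finset.sum_add_distrib, ← Finset.sum_add_distrib]
    exact Finset.sum_le_sum fun s _ => key s μ⁻¹ (inv_pos.2 hμ)
  have h3 : (∑ s ∈ Lo, b s) / μ ≤ (∑ v ∈ B, up (θ v)) / (μ ^ 3 * M) := by
    rw [div_le_div_iff₀ hμ (by positivity)]
    nlinarith
  have h4 : μ⁻¹ * ∑ s ∈ Hi, a s ≤ μ * M := by
    calc _ ≤ μ⁻¹ * (μ ^ 2 * M) := by gcongr
      _ = _ := by field_simp
  have h5 : (∑ s ∈ Hi, b s) / μ⁻¹ ≤ μ * M := by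
    rw [div_inv_eq_mul, mul_comm]
    gcongr
    exact hbM _
  have h6 : μ * ∑ s ∈ Lo, a s ≤ μ * M := by gcongr; exact haM _
  have h7 : labelEntropy θ d (A ∪ B) = ∑ s ∈ Lo, (a s + b s) * Real.log (a s + b s) +
      ∑ s ∈ Hi, (a s + b s) * Real.log (a s + b s) := by
    rw [← hsplit]
    exact Finset.sum_congr rfl fun s _ => by rw [hadd]
  have h8 : labelEntropy θ d A + labelEntropy θ d B =
      ∑ s ∈ Lo, (a s * Real.log (a s) + b s * Real.log (b s)) +
      ∑ s ∈ Hi, (a s * Real.log (a s) + b s * Real.log (b s)) := by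
    rw [← hsplit, Finset.sum_add_distrib]
    rfl
  rw [h7, h8]
  linarith

/-- The elements of `C` in the `a`-th dyadic block of length `2 ^ k`. -/
def dyadicBlock (C : Finset ℕ) (k a : ℕ) : Finset ℕ := C.filter fun v => v / 2 ^ k = a

/-- The elements of `C` below `v`, in the same dyadic block of length `2 ^ (j + 1)`, whose label is
at least the label of `v`. -/
def inversions (C : Finset ℕ) (θ : ℕ → ℕ) (j v : ℕ) : Finset ℕ :=
  (dyadicBlock C (j + 1) (v / 2 ^ (j + 1))).filter fun w => w < v ∧ θ v ≤ θ w

theorem card_dyadicBlock_le (C : Finset ℕ) (k a : ℕ) : (dyadicBlock C k a).card ≤ 2 ^ k := by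
  have : dyadicBlock C k a ⊆ Finset.Ico (a * 2 ^ k) (a * 2 ^ k + 2 ^ k) := by
    intro v hv
    have h := (Finset.mem_filter.1 hv).2
    have h1 := Nat.div_add_mod v (2 ^ k)
    have h2 := Nat.mod_lt v (show 0 < 2 ^ k by positivity)
    rw [h, mul_comm] at h1
    rw [Finset.mem_Ico]
    omega
  simpa using Finset.card_le_card this

theorem div_two_pow_succ (v k : ℕ) : v / 2 ^ (k + 1) = v / 2 ^ k / 2 := by
  rw [pow_succ, Nat.div_div_eq_div_mul]

/-- Iterate `labelEntropy_union_le` up the dyadic tree from singletons, whose entropy is zero.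
Merging halves of length `2^j` costs `3μ 2^j`, the same total on every level, and divides the
inversions by `2^j`. -/
theorem labelEntropy_dyadicBlock_le (C : Finset ℕ) (θ : ℕ → ℕ) (d : ℕ) {μ : ℝ} (hμ : 0 < μ)
    (k a : ℕ) :
    labelEntropy θ d (dyadicBlock C k a) ≤ 3 / 2 * μ * k * 2 ^ k +
      (∑ v ∈ dyadicBlock C k a, ∑ j ∈ Finset.range k,
        ((inversions C θ j v).card : ℝ) / 2 ^ j) / μ ^ 3 := by
  induction k generalizing a with
  | zero =>
    have h1 : labelEntropy θ d (dyadicBlock C 0 a) = 0 := by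
      refine Finset.sum_eq_zero fun s _ => ?_
      have h2 := (Finset.card_filter_le (dyadicBlock C 0 a) fun x => θ x = s).trans
        (card_dyadicBlock_le C 0 a)
      rw [pow_zero] at h2
      rcases Nat.le_one_iff_eq_zero_or_eq_one.1 h2 with h | h <;> simp [h]
    simp [h1]
  | succ k ih =>
    have hunion : dyadicBlock C (k + 1) a =
        dyadicBlock C k (2 * a) ∪ dyadicBlock C k (2 * a + 1) := by
      ext v
      simp only [dyadicBlock, Finset.mem_union, Finset.mem_filter, div_two_pow_succ]
      rw [← and_or_left]
      refine and_congr_right fun _ => ?_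
      omega
    have hdisj : Disjoint (dyadicBlock C k (2 * a)) (dyadicBlock C k (2 * a + 1)) := by
      rw [Finset.disjoint_left]
      intro v h1 h2
      have := (Finset.mem_filter.1 h1).2
      have := (Finset.mem_filter.1 h2).2
      omega
    have hcard : ∀ b, ((dyadicBlock C k b).card : ℝ) ≤ 2 ^ k := fun b => by
      exact_mod_cast card_dyadicBlock_le C k b
    have h := labelEntropy_union_le θ d hdisj (by positivity : (0 : ℝ) < 2 ^ k) hμ
      (hcard _) (hcard _)
    rw [← hunion] at h
    have hinv : ∑ v ∈ dyadicBlock C k (2 * a + 1),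
        (((dyadicBlock C k (2 * a)).filter fun w => θ v ≤ θ w).card : ℝ) ≤
        ∑ v ∈ dyadicBlock C (k + 1) a, ((inversions C θ k v).card : ℝ) := by
      refine (Finset.sum_le_sum fun v hv => ?_).trans
        (Finset.sum_le_sum_of_subset_of_nonneg (hunion ▸ Finset.subset_union_right)
          fun _ _ _ => Nat.cast_nonneg _)
      rw [Nat.cast_le]
      refine Finset.card_le_card fun w hw => ?_
      simp only [dyadicBlock, inversions, Finset.mem_filter, div_two_pow_succ] at hv hw ⊢
      refine ⟨⟨hw.1.1, by omega⟩, ?_, hw.2⟩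
      by_contra hc
      have := Nat.div_le_div_right (c := 2 ^ k) (not_lt.1 hc)
      omega
    have hsum : ∑ v ∈ dyadicBlock C (k + 1) a, ∑ j ∈ Finset.range (k + 1),
        ((inversions C θ j v).card : ℝ) / 2 ^ j =
        ∑ v ∈ dyadicBlock C k (2 * a), ∑ j ∈ Finset.range k,
          ((inversions C θ j v).card : ℝ) / 2 ^ j +
        ∑ v ∈ dyadicBlock C k (2 * a + 1), ∑ j ∈ Finset.range k,
          ((inversions C θ j v).card : ℝ) / 2 ^ j +
        (∑ v ∈ dyadicBlock C (k + 1) a, ((inversions C θ k v).card : ℝ)) / 2 ^ k := by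
      simp only [Finset.sum_range_succ, Finset.sum_add_distrib, Finset.sum_div]
      rw [← Finset.sum_union hdisj, ← hunion]
    have h2 := div_le_div_of_nonneg_right hinv (by positivity : (0 : ℝ) ≤ μ ^ 3 * 2 ^ k)
    have h3 := ih (2 * a)
    have h4 := ih (2 * a + 1)
    rw [hsum, add_div, add_div, div_div _ ((2 : ℝ) ^ k), mul_comm ((2 : ℝ) ^ k) (μ ^ 3)]
    push_cast
    rw [pow_succ]
    linarith

/-- Jensen's inequality for `x log x`, in the form of the tangent line at the mean class size `y =
|I| / d`. -/
theorem mul_log_div_le_labelEntropy {α : Type*} (θ : α → ℕ) {d : ℕ} (hd : 0 < d) (I : Finset α)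
    (hθ : ∀ x ∈ I, θ x < d) (hI : 0 < I.card) :
    (I.card : ℝ) * Real.log (I.card / d) ≤ labelEntropy θ d I := by
  have hd' : (0 : ℝ) < d := by exact_mod_cast hd
  have hI' : (0 : ℝ) < I.card := by exact_mod_cast hI
  have hsum : ∑ s ∈ Finset.range d, ((I.filter fun x => θ x = s).card : ℝ) = I.card := by
    rw [Finset.card_eq_sum_card_fiberwise (f := θ) (t := Finset.range d)
      (fun x hx => by simpa using hθ x hx)]
    push_cast
    rfl
  set y : ℝ := I.card / d with hy
  have hy0 : 0 < y := by positivity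
  have key : ∀ x : ℝ, 0 ≤ x → x * Real.log y + (x - y) ≤ x * Real.log x := by
    intro x hx
    rcases hx.eq_or_lt with rfl | hx
    · simp [hy0.le]
    · have h := Real.log_le_sub_one_of_pos (show 0 < y / x by positivity)
      rw [Real.log_div hy0.ne' hx.ne'] at h
      have := mul_le_mul_of_nonneg_left h hx.le
      have h2 : x * (y / x - 1) = y - x := by field_simp
      linarith
  have h1 : ∑ s ∈ Finset.range d, (((I.filter fun x => θ x = s).card : ℝ) * Real.log y +
      (((I.filter fun x => θ x = s).card : ℝ) - y)) ≤ labelEntropy θ d I :=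
    Finset.sum_le_sum fun s _ => key _ (Nat.cast_nonneg _)
  rw [Finset.sum_add_distrib, Finset.sum_sub_distrib, ← Finset.sum_mul, hsum, Finset.sum_const,
    Finset.card_range, nsmul_eq_mul] at h1
  have h2 : (d : ℝ) * y = I.card := by rw [hy]; field_simp
  linarith

/-- A labelling of most of `[2 ^ t]` with far fewer than `2 ^ t` labels has many inversions, counted
with a weight under which all dyadic scales contribute equally. -/
theorem le_sum_inversions {t d : ℕ} (hd : 0 < d) (C : Finset ℕ) (hC : ∀ v ∈ C, v < 2 ^ t)
    (hC2 : 2 ^ t ≤ 2 * C.card) (θ : ℕ → ℕ) (hθ : ∀ v ∈ C, θ v < d)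
    (hlog : (t : ℝ) / 20 ≤ Real.log (2 ^ t / (2 * d))) :
    (t : ℝ) * 2 ^ t / 138240000 ≤
      ∑ v ∈ C, ∑ j ∈ Finset.range t, ((inversions C θ j v).card : ℝ) / 2 ^ j := by
  have hblock : dyadicBlock C t 0 = C := by
    refine Finset.filter_true_of_mem fun v hv => Nat.div_eq_of_lt (hC v hv)
  -- With `μ = 1/120` the merging cost is `t 2^t / 80`, half of the lower bound `t 2^t / 40` found
  -- below. The other half, times `μ³`, gives `1/138240000`.
  have h1 := labelEntropy_dyadicBlock_le C θ d (show (0 : ℝ) < 1 / 120 by norm_num) t 0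
  rw [hblock] at h1
  have hpos : 0 < C.card := by
    have : 0 < 2 ^ t := by positivity
    omega
  have h2 := mul_log_div_le_labelEntropy θ hd C hθ hpos
  have hd' : (0 : ℝ) < d := by exact_mod_cast hd
  have hC3 : (2 : ℝ) ^ t / 2 ≤ C.card := by
    have : (2 : ℝ) ^ t ≤ 2 * C.card := by exact_mod_cast hC2
    linarith
  have h3 : Real.log (2 ^ t / (2 * d)) ≤ Real.log (C.card / d) := by
    apply Real.log_le_log (by positivity)
    rw [← div_div]
    gcongr
  have h4 : (2 : ℝ) ^ t / 2 * (t / 20) ≤ C.card * Real.log (C.card / d) :=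
    mul_le_mul hC3 (hlog.trans h3) (by positivity) (by positivity)
  norm_num at h1 ⊢
  linarith

/-! ### Medians and labels from longest paths -/

theorem exists_median {α : Type*} (W : Finset α) (f : α → ℕ) {d : ℕ} (hd : 0 < d)
    (hf : ∀ x ∈ W, f x < d) :
    ∃ θ < d, W.card ≤ 2 * (W.filter fun x => f x ≤ θ).card ∧
      W.card ≤ 2 * (W.filter fun x => θ ≤ f x).card := by
  have hex : ∃ θ, W.card ≤ 2 * (W.filter fun x => f x ≤ θ).card := by
    refine ⟨d - 1, ?_⟩
    rw [Finset.filter_true_of_mem fun x hx => by have := hf x hx; omega]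
    omega
  classical
  refine ⟨Nat.find hex, ?_, Nat.find_spec hex, ?_⟩
  · have : Nat.find hex ≤ d - 1 := Nat.find_min' hex (by
      rw [Finset.filter_true_of_mem fun x hx => by have := hf x hx; omega]
      omega)
    omega
  · rcases Nat.eq_zero_or_pos (Nat.find hex) with h | h
    · rw [h]
      simp only [zero_le, Finset.filter_true]
      omega
    · have h1 := Nat.find_min hex (show Nat.find hex - 1 < Nat.find hex by omega)
      have h2 := Finset.card_filter_add_card_filter_not (s := W) (fun x => f x ≤ Nat.find hex - 1)
      have h3 : (W.filter fun x => ¬ f x ≤ Nat.find hex - 1) =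
          W.filter fun x => Nat.find hex ≤ f x :=
        Finset.filter_congr fun x _ => by omega
      rw [h3] at h2
      omega

/-- If all directed paths that avoid `S` have fewer than `d` nodes, then the undeleted nodes have
labels below `d` that increase along edges. -/
theorem exists_labelling {V : Type*} {G : Digraph V} (hG : IsAcyclic G) (S : Finset V) {d : ℕ}
    (h : ∀ l, IsPathAvoiding G S l → l.length < d) :
    ∃ ℓ : V → ℕ, (∀ x, x ∉ S → ℓ x < d) ∧ ∀ x y, x ∉ S → y ∉ S → G.Adj x y → ℓ x < ℓ y := by
  classical
  -- The label of `x` is the length of a longest path off `S` that ends at `x`; acyclicity keeps its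
  -- extension by an edge simple.
  let P : V → ℕ → Prop := fun x m => ∃ l, IsPathAvoiding G S l ∧ l.getLast? = some x ∧ l.length = m
  have h1 : ∀ x, x ∉ S → P x 1 := fun x hx =>
    ⟨[x], ⟨by simp, by simp, by simp, by simpa using hx⟩, by simp, by simp⟩
  have hlt : ∀ x m, P x m → m < d := by
    rintro x m ⟨l, hl, -, rfl⟩
    exact h l hl
  have hspec : ∀ x, x ∉ S → P x (Nat.findGreatest (P x) d) := fun x hx =>
    Nat.findGreatest_spec (hlt x 1 (h1 x hx)).le (h1 x hx)
  refine ⟨fun x => Nat.findGreatest (P x) d, fun x hx => hlt x _ (hspec x hx), ?_⟩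
  intro x y hx hy hxy
  obtain ⟨l, ⟨hne, hchain, hnodup, hS⟩, hlast, hlen⟩ := hspec x hx
  have hP : P y (Nat.findGreatest (P x) d + 1) := by
    have hc : (l ++ [y]).IsChain G.Adj := by
      rw [List.isChain_append]
      refine ⟨hchain, by simp, ?_⟩
      intro a ha b hb
      rw [hlast] at ha
      simp only [Option.mem_def, Option.some.injEq, List.head?_cons] at ha hb
      exact ha ▸ hb ▸ hxy
    refine ⟨l ++ [y], ⟨by simp, hc, ?_, ?_⟩, by simp, by simp [hlen]⟩
    · refine (List.isChain_iff_pairwise.1 (hc.imp fun _ _ h => Relation.TransGen.single h)).imp ?_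
      rintro a b hab rfl
      exact hG a hab
    · intro v hv
      rcases List.mem_append.1 hv with hv | hv
      · exact hS v hv
      · rw [List.mem_singleton.1 hv]; exact hy
  exact Nat.lt_of_succ_le (Nat.le_findGreatest (hlt y _ hP).le hP)

theorem isAcyclic_of_rank {V : Type*} {G : Digraph V} (r : V → ℕ)
    (h : ∀ x y, G.Adj x y → r x < r y) : IsAcyclic G := by
  intro v hv
  have : ∀ x y, Relation.TransGen G.Adj x y → r x < r y := by
    intro x y hxy
    induction hxy with
    | single h1 => exact h _ _ h1
    | tail _ h1 ih => exact ih.trans (h _ _ h1)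
  exact lt_irrefl _ (this v v hv)

/-! ### The random multiscale graph -/

/-- The element with residue `r` in the dyadic block of length `2 ^ (j + 1)` around `v`. -/
def blockPoint (v j r : ℕ) : ℕ := v / 2 ^ (j + 1) * 2 ^ (j + 1) + r % 2 ^ (j + 1)

/-- Each node `(v, i)` of `[2 ^ t] × [n]` draws `τ` samples, each consisting of a scale, a point of
the dyadic block of that scale around `v`, and an index in `[n]`. Samples to the left of `v` become
incoming edges. -/
def multiscaleGraph {t n τ : ℕ}
    (ω : Fin (2 ^ t) → Fin n → Fin τ → Fin t × Fin (2 ^ t) × Fin n) :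
    Digraph (Fin (2 ^ t) × Fin n) where
  Adj x y := x.1 < y.1 ∧ ∃ k, blockPoint y.1 (ω y.1 y.2 k).1 (ω y.1 y.2 k).2.1 = x.1 ∧
    (ω y.1 y.2 k).2.2 = x.2

section

variable {t n τ : ℕ}

theorem isAcyclic_multiscaleGraph
    (ω : Fin (2 ^ t) → Fin n → Fin τ → Fin t × Fin (2 ^ t) × Fin n) :
    IsAcyclic (multiscaleGraph ω) :=
  isAcyclic_of_rank (fun x => x.1) fun _ _ h => h.1

theorem indegreeAtMost_multiscaleGraph
    (ω : Fin (2 ^ t) → Fin n → Fin τ → Fin t × Fin (2 ^ t) × Fin n) :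
    IndegreeAtMost (multiscaleGraph ω) τ := by
  intro y
  let f : Fin τ → Fin (2 ^ t) × Fin n := fun k =>
    (⟨blockPoint y.1 (ω y.1 y.2 k).1 (ω y.1 y.2 k).2.1 % 2 ^ t, Nat.mod_lt _ (by positivity)⟩,
      (ω y.1 y.2 k).2.2)
  have hsub : {u | (multiscaleGraph ω).Adj u y} ⊆ f '' Set.univ := by
    rintro ⟨w, i⟩ ⟨-, k, hk, hk'⟩
    refine ⟨k, trivial, Prod.ext (Fin.ext ?_) hk'⟩
    simp only [f, hk]
    exact Nat.mod_eq_of_lt w.2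
  refine (Set.encard_le_encard hsub).trans ((Set.encard_image_le _ _).trans ?_)
  simp

/-- The samples that would produce an edge into a node over `v`, from `U`, against the order of the
labels `θ`. -/
def descents (U : Finset (Fin (2 ^ t) × Fin n)) (θ : Fin (2 ^ t) → ℕ) (v : Fin (2 ^ t)) :
    Finset (Fin t × Fin (2 ^ t) × Fin n) := by
  classical exact Finset.univ.filter fun z => ∃ w : Fin (2 ^ t), blockPoint v z.1 z.2.1 = w ∧
    w < v ∧ θ v ≤ θ w ∧ (w, z.2.2) ∈ U

/-- The part of `U` over `v`. -/
def fibre (U : Finset (Fin (2 ^ t) × Fin n)) (v : Fin (2 ^ t)) : Finset (Fin n) := by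
  classical exact Finset.univ.filter fun i => (v, i) ∈ U

/-- The groups in which both `L` and `U` contain at least a quarter of the nodes. -/
def denseGroups (L U : Finset (Fin (2 ^ t) × Fin n)) : Finset (Fin (2 ^ t)) := by
  classical exact Finset.univ.filter fun v => n ≤ 4 * (fibre L v).card ∧ n ≤ 4 * (fibre U v).card

theorem mem_fibre {U : Finset (Fin (2 ^ t) × Fin n)} {v : Fin (2 ^ t)} {i : Fin n} :
    i ∈ fibre U v ↔ (v, i) ∈ U := by
  simp [fibre]

theorem mem_denseGroups {L U : Finset (Fin (2 ^ t) × Fin n)} {v : Fin (2 ^ t)} :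
    v ∈ denseGroups L U ↔ n ≤ 4 * (fibre L v).card ∧ n ≤ 4 * (fibre U v).card := by
  simp [denseGroups]

/-- Extend a labelling of `[2 ^ t]` to the natural numbers. -/
def extendLabel (θ : Fin (2 ^ t) → ℕ) (v : ℕ) : ℕ := if h : v < 2 ^ t then θ ⟨v, h⟩ else 0

@[simp] theorem extendLabel_coe (θ : Fin (2 ^ t) → ℕ) (v : Fin (2 ^ t)) :
    extendLabel θ v = θ v := by
  simp [extendLabel]

/-- An inversion `w` at scale `j` is hit by `2^(t-1-j)` points, those with the residue of `w` modulo
`2^(j+1)`, each combined with at least `n/4` indices of `U` over `w`. The product is at least `n 2^t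
/ (8 · 2^j)`, which explains the weight `2^(-j)`. -/
theorem le_card_descents (L U : Finset (Fin (2 ^ t) × Fin n)) (θ : Fin (2 ^ t) → ℕ)
    (v : Fin (2 ^ t)) :
    (n : ℝ) * 2 ^ t / 8 * ∑ j ∈ Finset.range t,
      ((inversions ((denseGroups L U).map Fin.valEmbedding) (extendLabel θ) j v).card : ℝ) / 2 ^ j ≤
      (descents U θ v).card := by
  classical
  set C := (denseGroups L U).map Fin.valEmbedding with hC
  let Z : Finset (Σ _ : Fin t, Σ _ : Fin (2 ^ t), Fin n × ℕ) :=
    Finset.univ.sigma fun j => (Finset.univ.filter fun w : Fin (2 ^ t) =>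
      (w : ℕ) ∈ inversions C (extendLabel θ) j v).sigma fun w =>
        fibre U w ×ˢ Finset.range (2 ^ (t - 1 - j))
  have hlt : ∀ (w j q : ℕ), j < t → q < 2 ^ (t - 1 - j) →
      q * 2 ^ (j + 1) + w % 2 ^ (j + 1) < 2 ^ t := by
    intro w j q hj hq
    have h1 : 2 ^ t = 2 ^ (t - 1 - j) * 2 ^ (j + 1) := by rw [← pow_add]; congr 1; omega
    have h2 := Nat.mod_lt w (show 0 < 2 ^ (j + 1) by positivity)
    have h3 : (q + 1) * 2 ^ (j + 1) ≤ 2 ^ (t - 1 - j) * 2 ^ (j + 1) := Nat.mul_le_mul_right _ hq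
    rw [h1]
    linarith
  let g : (Σ _ : Fin t, Σ _ : Fin (2 ^ t), Fin n × ℕ) → Fin t × Fin (2 ^ t) × Fin n := fun z =>
    (z.1, ⟨(z.2.2.2 * 2 ^ (z.1.1 + 1) + z.2.1 % 2 ^ (z.1.1 + 1)) % 2 ^ t,
      Nat.mod_lt _ (by positivity)⟩, z.2.2.1)
  have hZ : ∀ z ∈ Z, (z.2.1 : ℕ) / 2 ^ (z.1.1 + 1) = (v : ℕ) / 2 ^ (z.1.1 + 1) ∧ z.2.1 < v ∧
      θ v ≤ θ z.2.1 ∧ (z.2.1, z.2.2.1) ∈ U ∧ z.2.2.2 < 2 ^ (t - 1 - z.1.1) ∧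
      z.2.1 ∈ denseGroups L U := by
    rintro ⟨j, w, i, q⟩ hz
    simp only [Z, Finset.mem_sigma, Finset.mem_univ, true_and, Finset.mem_filter,
      Finset.mem_product, Finset.mem_range, mem_fibre, inversions, dyadicBlock,
      extendLabel_coe, hC, Finset.mem_map, Fin.valEmbedding_apply, Fin.val_inj,
      exists_eq_right] at hz
    exact ⟨hz.1.1.2, hz.1.2.1, hz.1.2.2, hz.2.1, hz.2.2, hz.1.1.1⟩
  have hcard : Z.card ≤ (descents U θ v).card := by
    refine Finset.card_le_card_of_injOn g ?_ ?_
    · rintro ⟨j, w, i, q⟩ hz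
      obtain ⟨h1, h2, h3, h4, h5, -⟩ := hZ _ hz
      simp only at h1 h2 h3 h4 h5
      simp only [descents, Finset.coe_filter, Finset.mem_univ, true_and, Set.mem_ofPred_eq, g]
      refine ⟨w, ?_, h2, h3, h4⟩
      rw [blockPoint, Nat.mod_eq_of_lt (hlt w j q j.2 h5), ← h1, Nat.mul_add_mod_self_right,
        Nat.mod_mod]
      exact Nat.div_add_mod' _ _
    · rintro ⟨j, w, i, q⟩ hz ⟨j', w', i', q'⟩ hz' he
      obtain ⟨h1, -, -, -, h5, -⟩ := hZ _ hz
      obtain ⟨h1', -, -, -, h5', -⟩ := hZ _ hz'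
      simp only at h1 h5 h1' h5'
      simp only [g, Prod.mk.injEq, Fin.mk.injEq] at he
      obtain ⟨rfl, h6, rfl⟩ := he
      rw [Nat.mod_eq_of_lt (hlt w j q j.2 h5), Nat.mod_eq_of_lt (hlt w' j q' j.2 h5')] at h6
      have hm : (w : ℕ) % 2 ^ (j.1 + 1) = w' % 2 ^ (j.1 + 1) := by
        have := congrArg (· % 2 ^ (j.1 + 1)) h6
        simpa [Nat.mul_add_mod_self_right] using this
      have hq : q = q' := by
        rw [hm] at h6
        exact Nat.eq_of_mul_eq_mul_right (by positivity) (Nat.add_right_cancel h6)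
      have hw : w = w' := by
        apply Fin.ext
        rw [← Nat.div_add_mod' w (2 ^ (j.1 + 1)), ← Nat.div_add_mod' w' (2 ^ (j.1 + 1)), h1, h1',
          hm]
      subst hq hw
      rfl
  have hZcard : (n : ℝ) * 2 ^ t / 8 * ∑ j ∈ Finset.range t,
      ((inversions C (extendLabel θ) j v).card : ℝ) / 2 ^ j ≤ Z.card := by
    rw [Finset.card_sigma, ← Fin.sum_univ_eq_sum_range
      (fun j => ((inversions C (extendLabel θ) j v).card : ℝ) / 2 ^ j), Finset.mul_sum]
    push_cast
    refine Finset.sum_le_sum fun j _ => ?_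
    rw [Finset.card_sigma]
    push_cast
    have h1 : ((inversions C (extendLabel θ) j v).card : ℝ) =
        ((Finset.univ.filter fun w : Fin (2 ^ t) =>
          (w : ℕ) ∈ inversions C (extendLabel θ) j v).card : ℝ) := by
      rw [← Finset.card_map Fin.valEmbedding]
      congr 2
      ext w
      simp only [Finset.mem_map, Finset.mem_filter, Finset.mem_univ, true_and,
        Fin.valEmbedding_apply]
      constructor
      · intro hw
        have : w ∈ C := (Finset.mem_filter.1 (Finset.mem_filter.1 hw).1).1
        obtain ⟨x, -, rfl⟩ := Finset.mem_map.1 this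
        exact ⟨x, hw, rfl⟩
      · rintro ⟨x, hx, rfl⟩
        exact hx
    have h4 : ∀ x : ℝ, (n : ℝ) * 2 ^ t / 8 * (x / 2 ^ j.1) = x * (n * 2 ^ t / 8 / 2 ^ j.1) :=
      fun x => by ring
    rw [h1, h4, ← nsmul_eq_mul]
    refine Finset.card_nsmul_le_sum _ (fun w => ((fibre U w ×ˢ Finset.range
      (2 ^ (t - 1 - j.1))).card : ℝ)) _ fun w hw => ?_
    have hwC : (w : ℕ) ∈ C :=
      (Finset.mem_filter.1 (Finset.mem_filter.1 (Finset.mem_filter.1 hw).2).1).1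
    have hw' : w ∈ denseGroups L U := by
      obtain ⟨x, hx, hxw⟩ := Finset.mem_map.1 hwC
      rwa [← Fin.ext hxw]
    have h2 : (n : ℝ) ≤ 4 * (fibre U w).card := by exact_mod_cast (mem_denseGroups.1 hw').2
    have h3 : (2 : ℝ) ^ t = 2 ^ (t - 1 - j.1) * 2 * 2 ^ j.1 := by
      rw [mul_assoc, ← pow_succ', ← pow_add]; congr 1; omega
    rw [Finset.card_product, Finset.card_range, h3]
    push_cast
    rw [div_div, div_le_iff₀ (by positivity)]
    have : (0 : ℝ) < 2 ^ (t - 1 - j.1) * 2 ^ j.1 := by positivity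
    nlinarith
  exact hZcard.trans (by exact_mod_cast hcard)

end

/-- A set of at most a quarter of the nodes leaves at least half of the groups half full. -/
theorem two_pow_le_two_mul_card_groups {t n : ℕ} (hn : 0 < n) (S : Finset (Fin (2 ^ t) × Fin n))
    (hS : 4 * S.card ≤ 2 ^ t * n) :
    2 ^ t ≤ 2 * (Finset.univ.filter fun v => n ≤ 2 * (fibre Sᶜ v).card).card := by
  have h1 := Finset.card_filter_add_card_filter_not (s := (Finset.univ : Finset (Fin (2 ^ t))))
    (fun v => n ≤ 2 * (fibre Sᶜ v).card)
  rw [Finset.card_univ, Fintype.card_fin] at h1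
  have h2 : S.card = ∑ v, (fibre S v).card := by
    rw [← Finset.card_sigma]
    refine Finset.card_nbij' (fun x => ⟨x.1, x.2⟩) (fun x => (x.1, x.2)) ?_ ?_ ?_ ?_ <;>
      simp [Set.MapsTo, Set.LeftInvOn, mem_fibre]
  have h3 : ∀ v, (fibre S v).card + (fibre Sᶜ v).card = n := by
    intro v
    have : fibre Sᶜ v = (fibre S v)ᶜ := by
      ext i
      simp [mem_fibre]
    rw [this, Finset.card_add_card_compl, Fintype.card_fin]
  have h4 : (Finset.univ.filter fun v => ¬ n ≤ 2 * (fibre Sᶜ v).card).card * n ≤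
      2 * S.card := by
    rw [h2, Finset.mul_sum]
    refine le_trans ?_ (Finset.sum_le_sum_of_subset (Finset.subset_univ
      (Finset.univ.filter fun v => ¬ n ≤ 2 * (fibre Sᶜ v).card)))
    rw [← smul_eq_mul]
    refine Finset.card_nsmul_le_sum _ _ _ fun v hv => ?_
    have := (Finset.mem_filter.1 hv).2
    have := h3 v
    omega
  have h5 : 2 * (Finset.univ.filter fun v => ¬ n ≤ 2 * (fibre Sᶜ v).card).card ≤ 2 ^ t := by
    refine Nat.le_of_mul_le_mul_right ?_ hn
    calc _ = 2 * ((Finset.univ.filter fun v => ¬ n ≤ 2 * (fibre Sᶜ v).card).card * n) := by ring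
      _ ≤ 2 * (2 * S.card) := Nat.mul_le_mul_left _ h4
      _ ≤ _ := by linarith
  omega

/-- If the multiscale graph has only short paths off `S`, its samples avoid all descents of some
labelling of the groups by few labels. -/
theorem exists_avoiding_descents {t n τ d : ℕ} (hn : 0 < n) (hd : 0 < d)
    (ω : Fin (2 ^ t) → Fin n → Fin τ → Fin t × Fin (2 ^ t) × Fin n)
    (S : Finset (Fin (2 ^ t) × Fin n)) (hS : 4 * S.card ≤ 2 ^ t * n)
    (h : ∀ l, IsPathAvoiding (multiscaleGraph ω) S l → l.length < d) :
    ∃ (L U : Finset (Fin (2 ^ t) × Fin n)) (θ : Fin (2 ^ t) → Fin d),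
      2 ^ t ≤ 2 * (denseGroups L U).card ∧
      ∀ v i k, (v, i) ∈ L → ω v i k ∉ descents U (fun w => θ w) v := by
  classical
  obtain ⟨ℓ, hℓd, hℓ⟩ := exists_labelling (isAcyclic_multiscaleGraph ω) S h
  have hmed := fun v : Fin (2 ^ t) => exists_median (fibre Sᶜ v) (fun i => ℓ (v, i)) hd
    fun i hi => hℓd _ (by simpa using mem_fibre.1 hi)
  choose θ hθd hθ1 hθ2 using hmed
  refine ⟨Finset.univ.filter fun x => x ∉ S ∧ ℓ x ≤ θ x.1,
    Finset.univ.filter fun x => x ∉ S ∧ θ x.1 ≤ ℓ x, fun v => ⟨θ v, hθd v⟩, ?_, ?_⟩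
  · refine (two_pow_le_two_mul_card_groups hn S hS).trans (Nat.mul_le_mul_left 2
      (Finset.card_le_card fun v hv => ?_))
    have hv := (Finset.mem_filter.1 hv).2
    rw [mem_denseGroups]
    have e1 : fibre (Finset.univ.filter fun x => x ∉ S ∧ ℓ x ≤ θ x.1) v =
        (fibre Sᶜ v).filter fun i => ℓ (v, i) ≤ θ v := by
      ext i
      simp [mem_fibre]
    have e2 : fibre (Finset.univ.filter fun x => x ∉ S ∧ θ x.1 ≤ ℓ x) v =
        (fibre Sᶜ v).filter fun i => θ v ≤ ℓ (v, i) := by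
      ext i
      simp [mem_fibre]
    rw [e1, e2]
    have := hθ1 v
    have := hθ2 v
    omega
  · intro v i k hvi hmem
    simp only [descents, Finset.mem_filter, Finset.mem_univ, true_and] at hvi hmem
    obtain ⟨w, hw, hwv, hθ, hwS, hwU⟩ := hmem
    -- Such an edge would give `ℓ(w, ·) < ℓ(v, i) ≤ θ v ≤ θ w ≤ ℓ(w, ·)`.
    have := hℓ _ _ hwS hvi.1 ⟨hwv, k, hw, rfl⟩
    have h2 : ℓ (v, i) ≤ θ v := hvi.2
    have h3 : θ w ≤ ℓ (w, (ω v i k).2.2) := hwU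
    omega

/-- If every outcome failed, each would avoid the descents of some triple `(L, U, θ)`. Each triple
forbids a share of samples that adds up to order `2^t n`, while `d ≤ 2^n` leaves at most `2^(3 · 2^t
n)` triples, so the avoiding outcomes cannot exhaust the sample space. -/
theorem exists_multiscaleGraph_forall_exists_path {t n d τ : ℕ} (ht : 0 < t) (hn : 0 < n)
    (hd : 0 < d) (hdn : d ≤ 2 ^ n) (hτ : (96 * 138240000 : ℝ) ≤ τ)
    (hlog : (t : ℝ) / 20 ≤ Real.log (2 ^ t / (2 * d))) :
    ∃ ω : Fin (2 ^ t) → Fin n → Fin τ → Fin t × Fin (2 ^ t) × Fin n,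
      ∀ S : Finset (Fin (2 ^ t) × Fin n), 4 * S.card ≤ 2 ^ t * n →
        ∃ l, IsPathAvoiding (multiscaleGraph ω) S l ∧ d ≤ l.length := by
  classical
  by_contra! hno
  let Δ : Finset (Finset (Fin (2 ^ t) × Fin n) × Finset (Fin (2 ^ t) × Fin n) ×
      (Fin (2 ^ t) → Fin d)) :=
    Finset.univ.filter fun x => 2 ^ t ≤ 2 * (denseGroups x.1 x.2.1).card
  let T : Finset (Fin (2 ^ t) × Fin n) × Finset (Fin (2 ^ t) × Fin n) × (Fin (2 ^ t) → Fin d) →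
      Fin (2 ^ t) → Fin n → Finset (Fin t × Fin (2 ^ t) × Fin n) := fun x v i =>
    if (v, i) ∈ x.1 then descents x.2.1 (fun w => x.2.2 w) v else ∅
  have hX : Fintype.card (Fin t × Fin (2 ^ t) × Fin n) = t * (2 ^ t * n) := by simp
  have hn0 : (0 : ℝ) < n := by exact_mod_cast hn
  have hσ : ∀ x ∈ Δ, (n : ℝ) * 2 ^ t / (32 * 138240000) *
      Fintype.card (Fin t × Fin (2 ^ t) × Fin n) ≤ ∑ v, ∑ i, ((T x v i).card : ℝ) := by
    rintro ⟨L, U, θ⟩ hx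
    have hx := (Finset.mem_filter.1 hx).2
    set C := (denseGroups L U).map Fin.valEmbedding with hC
    have h1 := le_sum_inversions (t := t) hd C
      (fun v hv => by obtain ⟨w, -, rfl⟩ := Finset.mem_map.1 hv; exact w.2)
      (by rwa [hC, Finset.card_map]) (extendLabel fun w => (θ w : ℕ))
      (fun v hv => by
        obtain ⟨w, -, rfl⟩ := Finset.mem_map.1 hv
        rw [Fin.valEmbedding_apply, extendLabel_coe]
        exact (θ w).2) hlog
    rw [hC, Finset.sum_map, ← hC] at h1
    have h2 : ∀ v, ∑ i, ((T (L, U, θ) v i).card : ℝ) =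
        (fibre L v).card * (descents U (fun w => (θ w : ℕ)) v).card := by
      intro v
      have : ∀ i, ((T (L, U, θ) v i).card : ℝ) =
          if i ∈ fibre L v then ((descents U (fun w => (θ w : ℕ)) v).card : ℝ) else 0 := by
        intro i
        simp only [T, mem_fibre]
        split_ifs <;> simp
      simp only [this]
      rw [Finset.sum_ite_mem, Finset.univ_inter, Finset.sum_const, nsmul_eq_mul]
    have h3 : ∀ v ∈ denseGroups L U, (n : ℝ) ^ 2 * 2 ^ t / 32 * ∑ j ∈ Finset.range t,
        ((inversions C (extendLabel fun w => (θ w : ℕ)) j v).card : ℝ) / 2 ^ j ≤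
        ∑ i, ((T (L, U, θ) v i).card : ℝ) := by
      intro v hv
      have h4 := le_card_descents L U (fun w => (θ w : ℕ)) v
      have h5 : (n : ℝ) / 4 ≤ (fibre L v).card := by
        have : (n : ℝ) ≤ 4 * (fibre L v).card := by exact_mod_cast (mem_denseGroups.1 hv).1
        linarith
      rw [h2]
      refine le_trans (le_of_eq ?_) (mul_le_mul h5 h4 (mul_nonneg (by positivity)
        (Finset.sum_nonneg fun _ _ => div_nonneg (Nat.cast_nonneg _) (by positivity)))
        (Nat.cast_nonneg _))
      ring
    rw [hX]
    push_cast
    calc (n : ℝ) * 2 ^ t / (32 * 138240000) * (t * (2 ^ t * n))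
        = (n : ℝ) ^ 2 * 2 ^ t / 32 * (t * 2 ^ t / 138240000) := by ring
      _ ≤ (n : ℝ) ^ 2 * 2 ^ t / 32 * ∑ v ∈ denseGroups L U, ∑ j ∈ Finset.range t,
          ((inversions C (extendLabel fun w => (θ w : ℕ)) j v).card : ℝ) / 2 ^ j :=
          mul_le_mul_of_nonneg_left h1 (by positivity)
      _ ≤ ∑ v ∈ denseGroups L U, ∑ i, ((T (L, U, θ) v i).card : ℝ) := by
          rw [Finset.mul_sum]
          exact Finset.sum_le_sum h3
      _ ≤ _ := Finset.sum_le_sum_of_subset_of_nonneg (Finset.subset_univ _)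
          fun _ _ _ => Finset.sum_nonneg fun _ _ => Nat.cast_nonneg _
  have hΔ : (Δ.card : ℝ) ≤ 2 ^ (3 * (2 ^ t * n)) := by
    have h1 : Δ.card ≤ 2 ^ (3 * (2 ^ t * n)) := by
      refine (Finset.card_filter_le _ _).trans ?_
      rw [Finset.card_univ, Fintype.card_prod, Fintype.card_prod, Fintype.card_finset,
        Fintype.card_prod, Fintype.card_fun, Fintype.card_fin, Fintype.card_fin, Fintype.card_fin]
      calc _ ≤ 2 ^ (2 ^ t * n) * (2 ^ (2 ^ t * n) * (2 ^ n) ^ 2 ^ t) := by gcongr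
        _ = _ := by rw [← pow_mul, mul_comm n, ← pow_add, ← pow_add]; congr 1; ring
    exact_mod_cast h1
  have hbound := card_exists_avoiding_le τ Δ T _ hσ (by rw [hX]; positivity)
  have hall : {ω : Fin (2 ^ t) → Fin n → Fin τ → Fin t × Fin (2 ^ t) × Fin n |
      ∃ x ∈ Δ, ∀ v i k, ω v i k ∉ T x v i} = Set.univ := by
    refine Set.eq_univ_of_forall fun ω => ?_
    obtain ⟨S, hS, hl⟩ := hno ω
    obtain ⟨L, U, θ, hLU, havoid⟩ := exists_avoiding_descents hn hd ω S hS hl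
    refine ⟨(L, U, θ), by simpa [Δ] using hLU, fun v i k => ?_⟩
    simp only [T]
    split_ifs with hvi
    · exact havoid v i k hvi
    · simp
  rw [hall, Set.ncard_univ] at hbound
  have hne : Nonempty (Fin (2 ^ t) → Fin n → Fin τ → Fin t × Fin (2 ^ t) × Fin n) :=
    ⟨fun _ _ _ => (⟨0, ht⟩, ⟨0, by positivity⟩, ⟨0, hn⟩)⟩
  have hpos : (0 : ℝ) < Nat.card (Fin (2 ^ t) → Fin n → Fin τ → Fin t × Fin (2 ^ t) × Fin n) := by
    exact_mod_cast Nat.card_pos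
  set N := Nat.card (Fin (2 ^ t) → Fin n → Fin τ → Fin t × Fin (2 ^ t) × Fin n) with hN
  have hexp : Real.exp (-(τ * ((n : ℝ) * 2 ^ t / (32 * 138240000)))) ≤
      Real.exp (-((3 * (2 ^ t * n) : ℕ) : ℝ)) := by
    apply Real.exp_le_exp.2
    push_cast
    have : (0 : ℝ) < n * 2 ^ t := by positivity
    rw [neg_le_neg_iff, mul_div_assoc', le_div_iff₀ (by norm_num)]
    nlinarith
  have hlt : (2 : ℝ) ^ (3 * (2 ^ t * n)) * Real.exp (-((3 * (2 ^ t * n) : ℕ) : ℝ)) < 1 := by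
    have h1 : 0 < 3 * (2 ^ t * n) := by positivity
    generalize 3 * (2 ^ t * n) = m at h1
    rw [Real.exp_neg, ← div_eq_mul_inv, div_lt_one (Real.exp_pos _), ← Real.exp_one_pow]
    exact pow_lt_pow_left₀ (by linarith [Real.exp_one_gt_d9]) (by norm_num) h1.ne'
  have : (N : ℝ) < N := by
    calc (N : ℝ) ≤ Δ.card * (N * Real.exp (-(τ * ((n : ℝ) * 2 ^ t / (32 * 138240000))))) := hbound
      _ ≤ 2 ^ (3 * (2 ^ t * n)) * (N * Real.exp (-((3 * (2 ^ t * n) : ℕ) : ℝ))) := by gcongr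
      _ = N * (2 ^ (3 * (2 ^ t * n)) * Real.exp (-((3 * (2 ^ t * n) : ℕ) : ℝ))) := by ring
      _ < N * 1 := by gcongr
      _ = N := mul_one _
  exact lt_irrefl _ this

/-! ### Depth-robust graphs of every size -/

/-- The image of a digraph under an embedding, all other nodes being isolated. -/
def embedDigraph {V W : Type*} (e : V ↪ W) (G : Digraph V) : Digraph W where
  Adj a b := ∃ x y, e x = a ∧ e y = b ∧ G.Adj x y

section

variable {V W : Type*} (e : V ↪ W) {G : Digraph V}

theorem IsAcyclic.embedDigraph (hG : IsAcyclic G) : IsAcyclic (embedDigraph e G) := by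
  have key : ∀ a b, Relation.TransGen (STRobust.embedDigraph e G).Adj a b →
      ∃ x y, e x = a ∧ e y = b ∧ Relation.TransGen G.Adj x y := by
    intro a b h
    induction h with
    | single h =>
      obtain ⟨x, y, rfl, rfl, h⟩ := h
      exact ⟨x, y, rfl, rfl, .single h⟩
    | tail _ h ih =>
      obtain ⟨x, y, rfl, rfl, hxy⟩ := ih
      obtain ⟨y', z, hy, rfl, h⟩ := h
      rw [e.injective hy] at h
      exact ⟨x, z, rfl, rfl, hxy.tail h⟩
  intro a ha
  obtain ⟨x, y, rfl, hy, h⟩ := key a a ha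
  rw [e.injective hy] at h
  exact hG x h

theorem IndegreeAtMost.embedDigraph {δ : ℕ} (hG : IndegreeAtMost G δ) :
    IndegreeAtMost (embedDigraph e G) δ := by
  intro b
  by_cases hb : ∃ y, e y = b
  · obtain ⟨y, rfl⟩ := hb
    have : {u | (STRobust.embedDigraph e G).Adj u (e y)} ⊆ e '' {x | G.Adj x y} := by
      rintro _ ⟨x, y', rfl, hy, h⟩
      rw [e.injective hy] at h
      exact ⟨x, h, rfl⟩
    exact (Set.encard_le_encard this).trans ((Set.encard_image_le _ _).trans (hG y))
  · have : {u | (STRobust.embedDigraph e G).Adj u b} = ∅ := by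
      ext u
      simp only [Set.mem_ofPred_eq, Set.mem_empty_iff_false, iff_false]
      rintro ⟨x, y, -, hy, -⟩
      exact hb ⟨y, hy⟩
    rw [this]
    simp

theorem exists_path_embedDigraph (S : Finset W) {d : ℝ}
    (h : ∀ S' : Finset V, S'.card ≤ S.card → ∃ l, IsPathAvoiding G S' l ∧ d ≤ (l.length : ℝ)) :
    ∃ l, IsPathAvoiding (embedDigraph e G) S l ∧ d ≤ (l.length : ℝ) := by
  classical
  obtain ⟨l, ⟨hne, hchain, hnodup, hS⟩, hl⟩ := h (S.preimage e e.injective.injOn)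
    (Finset.card_le_card_of_injOn e (fun x hx => by simpa using hx) e.injective.injOn)
  refine ⟨l.map e, ⟨by simpa using hne, ?_, hnodup.map e.injective, ?_⟩, by simpa using hl⟩
  · rw [List.isChain_map]
    exact hchain.imp fun a b h => ⟨a, b, rfl, rfl, h⟩
  · intro v hv
    obtain ⟨x, hx, rfl⟩ := List.mem_map.1 hv
    simpa using hS x hx

end

/-- For large `n` there is a digraph on `n` nodes of bounded indegree that keeps a path with
`n ^ (2 / 3)` nodes when few nodes are deleted. -/
theorem exists_depthRobust_of_large {n τ : ℕ} (hn : 2 ^ 72 ≤ n)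
    (hτ : (96 * 138240000 : ℝ) ≤ τ) :
    ∃ H : Digraph (Fin n), IsAcyclic H ∧ IndegreeAtMost H τ ∧
      DepthRobust H (1 / 8 * n) ((n : ℝ) ^ (2 / 3 : ℝ)) := by
  -- With `n ≈ 2^(6s)`, use `2^(5s)` groups of at least `2^s` nodes and `d = 2^(4s+4) ≥ n^(2/3)`;
  -- then `d` is smaller than the number of groups by a factor `2^(s-4)`. `s ≥ 12` is ample for `d ≤
  -- 2^m` and for the logarithmic condition.
  obtain ⟨s, hs, hs1, hs2⟩ : ∃ s, 12 ≤ s ∧ 2 ^ (6 * s) ≤ n ∧ n < 2 ^ (6 * s + 6) := by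
    have h1 := Nat.pow_log_le_self 2 (show n ≠ 0 by positivity)
    have h2 := Nat.lt_pow_succ_log_self (show 1 < 2 by norm_num) n
    have h3 : 72 ≤ Nat.log 2 n := Nat.le_log_of_pow_le (by norm_num) hn
    refine ⟨Nat.log 2 n / 6, by omega, le_trans (Nat.pow_le_pow_right (by norm_num) ?_) h1,
      h2.trans_le (Nat.pow_le_pow_right (by norm_num) ?_)⟩ <;> omega
  set m := n / 2 ^ (5 * s) with hm
  have hm1 : 2 ^ (5 * s) * m ≤ n := Nat.mul_div_le _ _
  have hm2 : n < 2 ^ (5 * s) * (m + 1) := Nat.lt_mul_div_succ _ (by positivity)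
  have hm3 : 2 ^ s ≤ m := by
    rw [hm, Nat.le_div_iff_mul_le (by positivity), ← pow_add]
    convert hs1 using 2
    ring
  have hm0 : 0 < m := lt_of_lt_of_le (by positivity) hm3
  have hn0 : (0 : ℝ) ≤ n := Nat.cast_nonneg _
  have hpow : (n : ℝ) ^ (2 / 3 : ℝ) ≤ ((2 ^ (4 * s + 4) : ℕ) : ℝ) := by
    have h1 : (n : ℝ) ≤ ((2 : ℝ) ^ (6 * s + 6)) := by exact_mod_cast hs2.le
    calc (n : ℝ) ^ (2 / 3 : ℝ) ≤ ((2 : ℝ) ^ (6 * s + 6)) ^ (2 / 3 : ℝ) :=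
          Real.rpow_le_rpow hn0 h1 (by norm_num)
      _ = _ := by
          rw [← Real.rpow_natCast, ← Real.rpow_mul (by norm_num)]
          push_cast
          rw [← Real.rpow_natCast]
          congr 1
          push_cast
          ring
  have hd : 2 ^ (4 * s + 4) ≤ 2 ^ m := by
    have h1 : ∀ k, 12 ≤ k → 4 * k + 4 ≤ 2 ^ k := by
      intro k hk
      induction k, hk using Nat.le_induction with
      | base => norm_num
      | succ k hk ih => rw [pow_succ]; omega
    exact Nat.pow_le_pow_right (by norm_num) ((h1 s hs).trans hm3)
  have hlog : ((5 * s : ℕ) : ℝ) / 20 ≤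
      Real.log (2 ^ (5 * s) / (2 * ((2 ^ (4 * s + 4) : ℕ) : ℝ))) := by
    have h1 : (2 : ℝ) ^ (5 * s) / (2 * ((2 ^ (4 * s + 4) : ℕ) : ℝ)) = 2 ^ (s - 5) := by
      rw [div_eq_iff (by positivity)]
      push_cast
      rw [← pow_succ', ← pow_add]
      congr 1
      omega
    rw [h1, Real.log_pow, Nat.cast_sub (by omega)]
    push_cast
    have : (12 : ℝ) ≤ s := by exact_mod_cast hs
    nlinarith [Real.log_two_gt_d9]
  obtain ⟨ω, hω⟩ := exists_multiscaleGraph_forall_exists_path (τ := τ) (by omega) hm0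
    (by positivity) hd hτ hlog
  let e : Fin (2 ^ (5 * s)) × Fin m ↪ Fin n :=
    finProdFinEquiv.toEmbedding.trans (Fin.castLEEmb hm1)
  refine ⟨embedDigraph e (multiscaleGraph ω), (isAcyclic_multiscaleGraph ω).embedDigraph e,
    (indegreeAtMost_multiscaleGraph ω).embedDigraph e, fun S hS => ?_⟩
  refine exists_path_embedDigraph e S fun S' hS' => ?_
  -- The grid covers more than half of the `n` nodes, so `n/8` deletions are at most a quarter of
  -- it.
  obtain ⟨l, hl, hlen⟩ := hω S' (by
    have h1 : (8 * S.card : ℝ) ≤ n := by linarith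
    have h2 : 8 * S.card ≤ n := by exact_mod_cast h1
    have h3 : 2 ^ (5 * s) * 1 ≤ 2 ^ (5 * s) * m := Nat.mul_le_mul_left _ hm0
    rw [mul_add] at hm2
    omega)
  exact ⟨l, hl, hpow.trans (by exact_mod_cast hlen)⟩

/-- The directed path on `n` nodes. -/
def pathDigraph (n : ℕ) : Digraph (Fin n) where
  Adj x y := (x : ℕ) + 1 = y

theorem isAcyclic_pathDigraph (n : ℕ) : IsAcyclic (pathDigraph n) :=
  isAcyclic_of_rank (fun x => x) fun x y h => by
    have : (x : ℕ) + 1 = y := h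
    omega

theorem indegreeAtMost_pathDigraph (n : ℕ) : IndegreeAtMost (pathDigraph n) 1 := by
  intro y
  rw [Nat.cast_one, Set.encard_le_one_iff]
  intro a b ha hb
  have h1 : (a : ℕ) + 1 = y := ha
  have h2 : (b : ℕ) + 1 = y := hb
  exact Fin.ext (by omega)

theorem depthRobust_pathDigraph {n : ℕ} (hn : 0 < n) {e : ℝ} (he : e < 1) :
    DepthRobust (pathDigraph n) e ((n : ℝ) ^ (2 / 3 : ℝ)) := by
  intro S hS
  have hS0 : S = ∅ := by
    rw [← Finset.card_eq_zero]
    have : (S.card : ℝ) < (1 : ℕ) := by push_cast; linarith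
    have : S.card < 1 := by exact_mod_cast this
    omega
  subst hS0
  refine ⟨List.finRange n, ⟨?_, ?_, List.nodup_finRange n, by simp⟩, ?_⟩
  · intro h
    have := congrArg List.length h
    simp at this
    omega
  · rw [List.isChain_iff_getElem]
    intro i hi
    simp [pathDigraph]
  · rw [List.length_finRange]
    have h1 : (1 : ℝ) ≤ n := by exact_mod_cast hn
    calc (n : ℝ) ^ (2 / 3 : ℝ) ≤ (n : ℝ) ^ (1 : ℝ) :=
          Real.rpow_le_rpow_of_exponent_le h1 (by norm_num)
      _ = n := Real.rpow_one _

theorem exists_isDepthRobustFamily :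
    ∃ c : ℝ, 0 < c ∧ ∃ (δ : ℕ) (H : (n : ℕ) → Digraph (Fin n)), IsDepthRobustFamily c δ H := by
  obtain ⟨τ, hτ⟩ := exists_nat_ge (96 * 138240000 : ℝ)
  have hτ1 : 1 ≤ τ := by
    have : (1 : ℝ) ≤ τ := le_trans (by norm_num) hτ
    exact_mod_cast this
  have hex : ∀ n : ℕ, ∃ H : Digraph (Fin n), 1 ≤ n → IsAcyclic H ∧ IndegreeAtMost H τ ∧
      DepthRobust H ((1 / 2 ^ 73 : ℝ) * n) ((n : ℝ) ^ (2 / 3 : ℝ)) := by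
    intro n
    rcases le_or_gt (2 ^ 72) n with h | h
    · obtain ⟨H, h1, h2, h3⟩ := exists_depthRobust_of_large h hτ
      refine ⟨H, fun _ => ⟨h1, h2, fun S hS => h3 S (hS.trans ?_)⟩⟩
      gcongr
      norm_num
    · refine ⟨pathDigraph n, fun hn => ⟨isAcyclic_pathDigraph n, fun v =>
        (indegreeAtMost_pathDigraph n v).trans (by exact_mod_cast hτ1),
        depthRobust_pathDigraph hn ?_⟩⟩
      have : (n : ℝ) < 2 ^ 72 := by exact_mod_cast h
      calc (1 / 2 ^ 73 : ℝ) * n < 1 / 2 ^ 73 * 2 ^ 72 := by gcongr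
        _ < 1 := by norm_num
  choose H hH using hex
  -- So small a `c` that `c n < 1` whenever `n < 2^72`: nothing can be deleted there, and a bare
  -- path suffices.
  exact ⟨1 / 2 ^ 73, by positivity, τ, H, hH⟩

end STRobust

theorem mainTheorem6 :
    (∃ c : ℝ, 0 < c ∧ ∃ (δ : ℕ) (H : (n : ℕ) → Digraph (Fin n)),
      STRobust.IsDepthRobustFamily c δ H) ∧
    (∀ c : ℝ, 0 < c → ∃ τ₀ : ℕ, ∀ τ : ℕ, τ₀ ≤ τ →
      ∀ (δ : ℕ) (H : (n : ℕ) → Digraph (Fin n)), STRobust.IsDepthRobustFamily c δ H →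
        ∀ n : ℕ, 1 ≤ n →
          1 - (2 : ℝ)⁻¹ ^ n ≤
            (ProbabilityTheory.uniformOn (Set.univ : Set (STRobust.Samples n τ))).real
              {ω | STRobust.RobustlyConnected c (STRobust.threeLayer (H n) ω)}) :=
  ⟨STRobust.exists_isDepthRobustFamily, STRobust.exists_robustlyConnected_of_isDepthRobustFamily⟩
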